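/- Definitions. Logarithms are to base $2$. Let $\mathcal{M}=(E,\mathcal{I})$ be a matroid on a finite ground set. For an ordering $\pi$ of $E$ let $C_\pi$ be the first circuit that appears when the elements are added in the order $\pi$ (it exists unless $\mathcal{M}$ has no circuit). For uniformly random $\pi$ and $T\subseteq E$ put $p_{T,\mathcal{M}}=\Pr_\pi[T\cap C_\pi\neq\emptyset]$ and $q_{T,\mathcal{M}}=\Pr_\pi[C_\pi\subseteq T]$. For $S\subseteq E$ let $\alpha(S)$ be the least $k\in\mathbb{N}$ such that a uniformly random $k$-element subset of $S$ is independent with probability at most $1/2$ (and $\alpha(S)=|S|+1$ if $S$ is independent). A set $S\subseteq E$ is *globally optimal* in $\mathcal{M}$ if $q_{S,\mathcal{M}}\ge 1-2^{-20}$ and $p_{T,\mathcal{M}|_S}\ge \frac{|T|}{2^{21}|S|\log |E|}$ for every $T\subseteq S$ (the latter condition being void if $|E|=1$). Lemma. There is a randomized adaptive algorithm with access to the independence oracle of an arbitrary matroid $\mathcal{M}$ on $n$ elements which always asks only $n^{O(1)}$ queries in total and works in rounds. In each round it asks a batch of non-adaptive queries and then either peels off a set or ends. For every such $\mathcal{M}$,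 if $S_1,\dots,S_k$ are the sets peeled off ($S_i$ in the $i$-th round), then with probability at least $1-2^{-\Omega(n)}$ all of the following hold. 1. Every $S_i$ is globally optimal in $\mathcal{M}_i:=\mathcal{M}-S_1-\dots-S_{i-1}$. 2. The algorithm does not end too early: either $\mathcal{M}_{k+1}$ has no circuit, or in its last round the algorithm has found (and not returned) a set $S$ that is globally optimal in $\mathcal{M}_{k+1}$ and satisfies $\alpha(S)/|S|\ge 1/\log n$ or $|S|>n/2$ (for $n=1$ this last alternative imposes no condition on $\alpha(S)$ or $|S|$). 3. For every integer $\ell\ge 0$, let $a_1<\dots<a_\gamma$ be the indices $i\in\{1,\dots,k\}$ with $|S_i|\in[2^\ell,2^{\ell+1}-1]$. Then $\alpha(S_{a_i})=\Omega(i^2)$ for every $i\in\{1,\dots,\gamma\}$, and $\gamma=O(\sqrt{2^\ell})$. 4. $k=O(n^{1/3})$. 5. For all $1\le i<j\le k$, $\ \frac{\alpha(S_j)}{|S_j|}=\Omega\!\left(\frac{\alpha(S_i)}{|S_i|}\right)$. All implied constants are absolute. -/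

import Mathlib

/-- Uniform probability of the event `P` on a finite sample space `Ω`
(it is `0` when `Ω` is empty). -/
noncomputable def unifProb {Ω : Type*} (P : Ω → Prop) : ℝ :=
  (Nat.card {ω : Ω // P ω} : ℝ) / (Nat.card Ω : ℝ)

namespace Matroid

variable {V : Type*}

/-- `α(S)`: the least `k` such that a uniformly random `k`-element subset of `S` is independent
with probability at most `1/2`. If `S` is itself independent, no `k ≤ |S|` qualifies and the value
is `|S| + 1`, there being no subset of that size. -/
noncomputable def alpha (M : Matroid V) (S : Finset V) : ℕ :=
  sInf {k : ℕ | unifProb (Ω := {T : Finset V // T ⊆ S ∧ T.card = k})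
    (fun T => M.Indep (T.1 : Set V)) ≤ 1 / 2}

/-- The permutations of the ground set of `M`, as bijections `π : {0, …, |E| - 1} → E`. -/
abbrev Ordering (M : Matroid V) : Type _ := Fin (Nat.card M.E) ≃ M.E

/-- The set of the first `j` elements in the order `π`. -/
def firstElements (M : Matroid V) (π : M.Ordering) (j : ℕ) : Set V :=
  {x | ∃ i : Fin (Nat.card M.E), (i : ℕ) < j ∧ (π i : V) = x}

/-- `C = C_π`: the circuit that appears first when the elements are added in the order `π`, that is,
the circuit contained in the first dependent prefix. There is no such `C` if `M` has no circuit. -/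
def IsFirstCircuit (M : Matroid V) (π : M.Ordering) (C : Set V) : Prop :=
  M.IsCircuit C ∧ ∃ j : ℕ, M.Indep (M.firstElements π j) ∧
    ¬ M.Indep (M.firstElements π (j + 1)) ∧ C ⊆ M.firstElements π (j + 1)

/-- The hitting probability `p_{T, M} = Pr_π[T ∩ C_π ≠ ∅]`. -/
noncomputable def hittingProb (M : Matroid V) (T : Finset V) : ℝ :=
  unifProb fun π : M.Ordering => ∃ C, M.IsFirstCircuit π C ∧ ((T : Set V) ∩ C).Nonempty

/-- The circuit mass `q_{T, M} = Pr_π[C_π ⊆ T]`. -/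
noncomputable def circuitMass (M : Matroid V) (T : Finset V) : ℝ :=
  unifProb fun π : M.Ordering => ∃ C, M.IsFirstCircuit π C ∧ C ⊆ (T : Set V)

/-- `S` is globally optimal in `M`; logarithms are to base `2`. -/
def GloballyOptimal (M : Matroid V) (S : Finset V) : Prop :=
  (S : Set V) ⊆ M.E ∧
  1 - (1 / 2 : ℝ) ^ 20 ≤ M.circuitMass S ∧
  ∀ T : Finset V, T ⊆ S →
    (T.card : ℝ) / (2 ^ 21 * (S.card : ℝ) * Real.logb 2 (Nat.card M.E)) ≤
      (M.restrict (S : Set V)).hittingProb T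

/-- The matroid left over from `M` after deleting all sets in the list `L`. -/
def peelOff (M : Matroid V) (L : List (Finset V)) : Matroid V :=
  M.delete {x | ∃ S ∈ L, x ∈ S}

open Classical in
/-- The independence oracle of `M`. -/
noncomputable def indepOracle (M : Matroid V) : Finset V → Bool :=
  fun A => decide (M.Indep (A : Set V))

end Matroid

/-- What a peeling algorithm does at the end of a round: peel off a set and go on, or end the run
because the set it has found is rejected, or end the run without having found a set. -/
inductive RoundOutcome (V : Type*) where
  | peel (S : Finset V)
  | reject (S : Finset V)
  | done

/-- A (deterministic) adaptive peeling algorithm with oracle access to a family of subsets of `V`.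
In each round it asks a batch `Q` of queries in parallel; the outcome of the round and the further
course of the algorithm depend on the answers it has received so far, and on nothing else. -/
inductive PeelingAlgorithm (V : Type*) where
  | halt
  | round (Q : Finset (Finset V)) (outcome : ({A // A ∈ Q} → Bool) → RoundOutcome V)
      (next : ({A // A ∈ Q} → Bool) → PeelingAlgorithm V)

namespace PeelingAlgorithm

variable {V : Type*}

/-- The sets `S₁, …, S_k` peeled off in a run (one in each round), and the set that was found last
and rejected, if the run ended with a rejection. -/
def run : PeelingAlgorithm V → (Finset V → Bool) → List (Finset V) × Option (Finset V)
  | halt, _ => ([], none)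
  | round _ outcome next, O =>
    match outcome (fun A => O A.1) with
    | .peel S => (S :: ((next fun A => O A.1).run O).1, ((next fun A => O A.1).run O).2)
    | .reject S => ([], some S)
    | .done => ([], none)

/-- The total number of queries asked in a run. -/
def queryCount : PeelingAlgorithm V → (Finset V → Bool) → ℕ
  | halt, _ => 0
  | round Q outcome next, O =>
    Q.card +
      match outcome (fun A => O A.1) with
      | .peel _ => (next fun A => O A.1).queryCount O
      | .reject _ => 0
      | .done => 0

end PeelingAlgorithm

/-- The stopping rule of the decomposition: having peeled off the sets in `L`, the algorithm ends
only if no circuit is left, or if it has found a globally optimal set `S` of the remaining matroid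
with `α(S)/|S| ≥ 1/log n` or `|S| > n/2`, where `n` is the number of elements of `M`. -/
def StoppingRule {V : Type*} (M : Matroid V) (L : List (Finset V)) :
    Option (Finset V) → Prop
  | none => ∀ C, ¬ (M.peelOff L).IsCircuit C
  | some S => (M.peelOff L).GloballyOptimal S ∧
      (1 / Real.logb 2 (Nat.card M.E) ≤ (M.alpha S : ℝ) / (S.card : ℝ) ∨
        (Nat.card M.E : ℝ) / 2 < (S.card : ℝ))

/-- The indices of the sets in `L` whose size lies in `[2 ^ l, 2 ^ (l + 1) - 1]`. -/
def sizeClass {V : Type*} (L : List (Finset V)) (l : ℕ) : Finset (Fin L.length) :=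
  {i | 2 ^ l ≤ (L.get i).card ∧ (L.get i).card ≤ 2 ^ (l + 1) - 1}

/-! The algorithm draws one batch of `2 ^ 50 * n ^ 5` random permutations and reuses it in every
round. A Chernoff bound and a union bound over all `4 ^ n` pairs `(R, X)` show that, except with
probability `2 ^ (-n)`, the sampled frequencies approximate the circuit mass of every `X` in every
restriction `M|R` to within `2 ^ (-23) / n ^ 2`. The adaptive choice of the sets then does no harm.
On the remaining set `R` each round maximises frequency minus `2 ^ (-20) * ln |S| / log |R|`.
Comparing the maximiser `S` with `R` gives its circuit mass, and comparing it with `S \ T` gives the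
lower bound on the hitting probability of `T` (`globallyOptimal_bestSet`). Peeling continues until
no circuit is left.

All other conclusions hold for every list of successively globally optimal sets and use only the
circuit masses. Let `S` be peeled before `U`, and let `X` contain each element independently with
probability `t`. If `X ∩ S` is independent and `X ∩ U` is dependent, a first circuit completed by
then cannot lie in `S`. As `S` and `U` are disjoint, this gives `(1 - depProb S t) * depProb U t ≤ 2
^ (-20)` (`one_sub_depProb_mul_depProb_le`).

With `t = sin θ ^ 2`, dependence probabilities are `2 * √|S|`-Lipschitz in the angle `θ`
(`abs_bernoulliAvg_sub_le`). Hence the angle at which dependence first has probability `1/4` grows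
by at least `1 / (4 * √|S|)` from `S` to any later set (`IsDependenceAngle.add_le`). Angles are at
most `π / 2`, so only `O(√B)` peeled sets have size at most `B`; with `B = n ^ (2/3)` and
disjointness for the larger sets this bounds the number of rounds. Since `θ ^ 2 * |S| = O(α(S))`,
the growth of the angles also bounds `α` below within a size class. The near-monotonicity of `α(S) /
|S|` is the product inequality at `t = 4 * α(U) / |U|`. -/

/-! ### Uniform probabilities and a Chernoff bound. -/

section UnifProb

theorem unifProb_eq_card_filter {Ω : Type*} [Fintype Ω] (P : Ω → Prop) [DecidablePred P] :
    unifProb P = ((Finset.univ.filter P).card : ℝ) / (Fintype.card Ω : ℝ) := by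
  rw [unifProb, Nat.card_eq_fintype_card, Nat.card_eq_fintype_card, Fintype.card_subtype]

theorem unifProb_nonneg {Ω : Type*} (P : Ω → Prop) : 0 ≤ unifProb P := by
  unfold unifProb; positivity

theorem unifProb_mono {Ω : Type*} [Finite Ω] {P Q : Ω → Prop} (h : ∀ ω, P ω → Q ω) :
    unifProb P ≤ unifProb Q := by
  classical
  have := Fintype.ofFinite Ω
  rw [unifProb_eq_card_filter, unifProb_eq_card_filter]
  gcongr with ω
  exact h ω

theorem unifProb_le_one {Ω : Type*} [Finite Ω] (P : Ω → Prop) : unifProb P ≤ 1 := by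
  classical
  have := Fintype.ofFinite Ω
  rw [unifProb_eq_card_filter]
  refine div_le_one_of_le₀ ?_ (by positivity)
  exact_mod_cast Finset.card_le_univ _

theorem unifProb_of_forall {Ω : Type*} [Finite Ω] [Nonempty Ω] {P : Ω → Prop} (h : ∀ ω, P ω) :
    unifProb P = 1 := by
  classical
  have := Fintype.ofFinite Ω
  rw [unifProb_eq_card_filter, Finset.filter_true_of_mem fun x _ => h x, Finset.card_univ]
  exact div_self (by exact_mod_cast Fintype.card_ne_zero)

theorem unifProb_of_forall_not {Ω : Type*} {P : Ω → Prop} (h : ∀ ω, ¬ P ω) :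
    unifProb P = 0 := by
  have : IsEmpty {ω // P ω} := ⟨fun x => h x.1 x.2⟩
  simp [unifProb]

theorem unifProb_or_le {Ω : Type*} [Finite Ω] (P Q : Ω → Prop) :
    unifProb (fun ω => P ω ∨ Q ω) ≤ unifProb P + unifProb Q := by
  classical
  have := Fintype.ofFinite Ω
  rw [unifProb_eq_card_filter, unifProb_eq_card_filter, unifProb_eq_card_filter, ← add_div]
  gcongr
  rw [Finset.filter_or]
  exact_mod_cast Finset.card_union_le _ _

theorem unifProb_exists_le {Ω ι : Type*} [Finite Ω] [Fintype ι] (P : ι → Ω → Prop) :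
    unifProb (fun ω => ∃ i, P i ω) ≤ ∑ i, unifProb (P i) := by
  classical
  have := Fintype.ofFinite Ω
  simp only [unifProb_eq_card_filter, ← Finset.sum_div]
  gcongr
  have : (Finset.univ.filter fun ω => ∃ i, P i ω) =
      Finset.univ.biUnion fun i => Finset.univ.filter (P i) := by ext; simp
  rw [this]
  exact_mod_cast Finset.card_biUnion_le

theorem unifProb_not {Ω : Type*} [Finite Ω] [Nonempty Ω] (P : Ω → Prop) :
    unifProb (fun ω => ¬ P ω) = 1 - unifProb P := by
  classical
  have := Fintype.ofFinite Ω
  rw [unifProb_eq_card_filter, unifProb_eq_card_filter]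
  have h0 : (Fintype.card Ω : ℝ) ≠ 0 := by exact_mod_cast Fintype.card_ne_zero
  have := Finset.card_filter_add_card_filter_not (s := (Finset.univ : Finset Ω)) P
  rw [Finset.card_univ] at this
  rw [eq_sub_iff_add_eq, ← add_div, div_eq_one_iff_eq h0]
  exact_mod_cast (by omega)

/-- A map all of whose fibres are carried into each other by permutations of the source transports
the uniform distribution to the uniform distribution. -/
theorem unifProb_comp {A B : Type*} [Finite A] [Nonempty A] [Finite B] (φ : A → B)
    (h : ∀ b b', ∃ e : A ≃ A, ∀ a, φ a = b → φ (e a) = b') (P : B → Prop) :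
    unifProb (fun a => P (φ a)) = unifProb P := by
  classical
  have := Fintype.ofFinite A
  have := Fintype.ofFinite B
  have hle : ∀ b b', (Finset.univ.filter fun a => φ a = b).card ≤
      (Finset.univ.filter fun a => φ a = b').card := by
    intro b b'
    obtain ⟨e, he⟩ := h b b'
    refine Finset.card_le_card_of_injOn e ?_ e.injective.injOn
    intro a ha
    simp only [Finset.coe_filter, Finset.mem_univ, true_and, Set.mem_ofPred_eq] at ha ⊢
    exact he a ha
  obtain ⟨a₀⟩ := ‹Nonempty A›
  set m := (Finset.univ.filter fun a => φ a = φ a₀).card with hm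
  have hfib : ∀ b, (Finset.univ.filter fun a => φ a = b).card = m :=
    fun b => le_antisymm (hle _ _) (hle _ _)
  have hm0 : 0 < m := Finset.card_pos.2 ⟨a₀, by simp⟩
  have hA : Fintype.card A = Fintype.card B * m := by
    have := Finset.card_eq_sum_card_fiberwise (f := φ) (s := Finset.univ) (t := Finset.univ)
      (fun _ _ => Finset.mem_coe.2 (Finset.mem_univ _))
    rw [Finset.card_univ] at this
    rw [this, Finset.sum_congr rfl fun b _ => hfib b]
    simp
  have hP : (Finset.univ.filter fun a => P (φ a)).card = (Finset.univ.filter P).card * m := by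
    have := Finset.card_eq_sum_card_fiberwise (f := φ) (s := Finset.univ.filter fun a => P (φ a))
      (t := Finset.univ.filter P) (fun a ha => by simpa using ha)
    rw [this, Finset.sum_congr rfl (g := fun _ => m)]
    · simp
    · intro b hb
      rw [← hfib b, Finset.filter_filter]
      congr 1
      ext a
      simp only [Finset.mem_filter, Finset.mem_univ, true_and] at hb ⊢
      constructor
      · exact fun h => h.2
      · rintro rfl; exact ⟨hb, rfl⟩
  rw [unifProb_eq_card_filter, unifProb_eq_card_filter, hA, hP]
  push_cast
  exact mul_div_mul_right _ _ (by exact_mod_cast hm0.ne')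

/-- A Chernoff bound for sums of independent centred variables with values in `[-1, 1]`. -/
theorem unifProb_sum_ge_le {A : Type*} [Fintype A] [Nonempty A] (y : A → ℝ)
    (hy : ∀ a, |y a| ≤ 1) (hsum : ∑ a, y a = 0) (N : ℕ) {δ : ℝ} (h0 : 0 ≤ δ) (h1 : δ ≤ 1) :
    unifProb (fun ω : Fin N → A => N * δ ≤ ∑ i, y (ω i)) ≤ Real.exp (-(N * δ ^ 2 / 4)) := by
  classical
  have hc : (0 : ℝ) < Fintype.card A := by exact_mod_cast Fintype.card_pos
  -- The parameter `δ / 2` minimises the exponent `N * (s ^ 2 - s * δ)` over `s`.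
  have hmgf : ∑ a, Real.exp (δ / 2 * y a) ≤ Fintype.card A * Real.exp ((δ / 2) ^ 2) := by
    have : ∀ a, Real.exp (δ / 2 * y a) ≤ 1 + δ / 2 * y a + (δ / 2) ^ 2 := by
      intro a
      have hya := hy a
      have hsq : y a ^ 2 ≤ 1 := by rw [← sq_abs]; nlinarith [abs_nonneg (y a)]
      have hle : |δ / 2 * y a| ≤ 1 := by
        rw [abs_mul, abs_of_nonneg (by linarith : 0 ≤ δ / 2)]
        nlinarith [abs_nonneg (y a)]
      have := (abs_le.1 (Real.abs_exp_sub_one_sub_id_le hle)).2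
      have h2 : (δ / 2 * y a) ^ 2 ≤ (δ / 2) ^ 2 := by
        rw [mul_pow]; nlinarith [sq_nonneg (δ / 2)]
      linarith
    calc ∑ a, Real.exp (δ / 2 * y a) ≤ ∑ a, (1 + δ / 2 * y a + (δ / 2) ^ 2) :=
          Finset.sum_le_sum fun a _ => this a
      _ = Fintype.card A * (1 + (δ / 2) ^ 2) := by
          simp only [Finset.sum_add_distrib, ← Finset.mul_sum, hsum]
          simp; ring
      _ ≤ _ := by
          gcongr
          linarith [Real.add_one_le_exp ((δ / 2) ^ 2)]
  have hpow : ∑ ω : Fin N → A, Real.exp (δ / 2 * ∑ i, y (ω i)) ≤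
      Fintype.card A ^ N * Real.exp (N * (δ / 2) ^ 2) := by
    calc ∑ ω : Fin N → A, Real.exp (δ / 2 * ∑ i, y (ω i))
        = ∑ ω : Fin N → A, ∏ i, Real.exp (δ / 2 * y (ω i)) := by
          refine Finset.sum_congr rfl fun ω _ => ?_
          rw [Finset.mul_sum, Real.exp_sum]
      _ = (∑ a, Real.exp (δ / 2 * y a)) ^ N := by
          convert (Fintype.sum_pow (fun a => Real.exp (δ / 2 * y a)) N).symm
      _ ≤ (Fintype.card A * Real.exp ((δ / 2) ^ 2)) ^ N := by gcongr
      _ = _ := by rw [mul_pow, ← Real.exp_nat_mul]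
  have hcount : ((Finset.univ.filter fun ω : Fin N → A => N * δ ≤ ∑ i, y (ω i)).card : ℝ) *
      Real.exp (δ / 2 * (N * δ)) ≤ Fintype.card A ^ N * Real.exp (N * (δ / 2) ^ 2) := by
    refine le_trans ?_ hpow
    rw [← nsmul_eq_mul, ← Finset.sum_const]
    refine (Finset.sum_le_sum fun ω hω => ?_).trans
      (Finset.sum_le_sum_of_subset_of_nonneg (Finset.subset_univ _) fun _ _ _ => by positivity)
    simp only [Finset.mem_filter, Finset.mem_univ, true_and] at hω
    gcongr
  rw [unifProb_eq_card_filter, div_le_iff₀ (by exact_mod_cast Fintype.card_pos)]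
  simp only [Fintype.card_fun, Fintype.card_fin, Nat.cast_pow]
  rw [← le_div_iff₀ (Real.exp_pos _)] at hcount
  refine hcount.trans (le_of_eq ?_)
  rw [mul_div_assoc, ← Real.exp_sub, mul_comm]
  congr 2
  ring

theorem unifProb_abs_freq_sub_le {A : Type*} [Fintype A] [Nonempty A] (P : A → Prop) {N : ℕ}
    (hN : 0 < N) {δ : ℝ} (h0 : 0 ≤ δ) (h1 : δ ≤ 1) :
    unifProb (fun ω : Fin N → A => δ < |(Nat.card {i // P (ω i)} : ℝ) / N - unifProb P|) ≤
      2 * Real.exp (-(N * δ ^ 2 / 4)) := by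
  classical
  have hc : (Fintype.card A : ℝ) ≠ 0 := by exact_mod_cast Fintype.card_ne_zero
  set p := unifProb P with hp
  have hp0 : 0 ≤ p := unifProb_nonneg P
  have hp1 : p ≤ 1 := unifProb_le_one P
  let y : A → ℝ := fun a => (if P a then 1 else 0) - p
  have hy : ∀ a, |y a| ≤ 1 := by
    intro a
    simp only [y, abs_le]
    split_ifs <;> constructor <;> linarith
  have hsum : ∑ a, y a = 0 := by
    simp only [y, Finset.sum_sub_distrib, Finset.sum_boole, Finset.sum_const, Finset.card_univ,
      nsmul_eq_mul]
    rw [hp, unifProb_eq_card_filter]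
    field_simp
    simp
  have hN' : (0 : ℝ) < N := by exact_mod_cast hN
  have hfreq : ∀ ω : Fin N → A, ∑ i, y (ω i) = (Nat.card {i // P (ω i)} : ℝ) - N * p := by
    intro ω
    simp only [y, Finset.sum_sub_distrib, Finset.sum_boole, Finset.sum_const, Finset.card_univ,
      nsmul_eq_mul, Nat.card_eq_fintype_card, Fintype.card_subtype, Fintype.card_fin]
  have e1 := unifProb_sum_ge_le y hy hsum N h0 h1
  have e2 := unifProb_sum_ge_le (fun a => - y a) (by simpa using hy) (by simp [hsum]) N h0 h1
  rw [two_mul]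
  refine le_trans ?_ (add_le_add e1 e2)
  refine le_trans (unifProb_mono ?_) (unifProb_or_le _ _)
  intro ω hω
  rw [Finset.sum_neg_distrib, hfreq]
  rcases lt_abs.1 hω with h | h
  · left
    rw [lt_sub_iff_add_lt, lt_div_iff₀ hN'] at h
    nlinarith
  · right
    have : (Nat.card {i // P (ω i)} : ℝ) / N < p - δ := by linarith
    rw [div_lt_iff₀ hN'] at this
    nlinarith

end UnifProb

/-! ### Random orders and first circuits. -/

section Orders

variable {n : ℕ}

/-- The elements that come first in the order given by the permutation `σ`. -/
def permPrefix (σ : Equiv.Perm (Fin n)) (k : ℕ) : Finset (Fin n) :=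
  Finset.univ.filter fun x => (σ x : ℕ) < k

theorem mem_permPrefix {σ : Equiv.Perm (Fin n)} {k : ℕ} {x : Fin n} :
    x ∈ permPrefix σ k ↔ (σ x : ℕ) < k := by
  simp [permPrefix]

theorem permPrefix_mono (σ : Equiv.Perm (Fin n)) {k l : ℕ} (h : k ≤ l) :
    permPrefix σ k ⊆ permPrefix σ l := fun _ hx =>
  mem_permPrefix.2 ((mem_permPrefix.1 hx).trans_le h)

theorem permPrefix_zero (σ : Equiv.Perm (Fin n)) : permPrefix σ 0 = ∅ := by
  ext; simp [mem_permPrefix]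

theorem permPrefix_of_le (σ : Equiv.Perm (Fin n)) {k : ℕ} (h : n ≤ k) :
    permPrefix σ k = Finset.univ := by
  ext x; simp only [mem_permPrefix, Finset.mem_univ, iff_true]; omega

theorem permPrefix_succ (σ : Equiv.Perm (Fin n)) {k : ℕ} (h : k < n) :
    permPrefix σ (k + 1) = insert (σ.symm ⟨k, h⟩) (permPrefix σ k) := by
  ext x
  simp only [mem_permPrefix, Finset.mem_insert, Equiv.eq_symm_apply, Fin.ext_iff]
  omega

theorem permPrefix_trans (σ g : Equiv.Perm (Fin n)) (k : ℕ) :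
    permPrefix (g.symm.trans σ) k = (permPrefix σ k).map g.toEmbedding := by
  ext x
  simp only [mem_permPrefix, Equiv.trans_apply, Finset.mem_map_equiv]

theorem card_permPrefix (σ : Equiv.Perm (Fin n)) {k : ℕ} (h : k ≤ n) :
    (permPrefix σ k).card = k := by
  induction k with
  | zero => simp [permPrefix_zero]
  | succ k ih =>
    rw [permPrefix_succ σ h, Finset.card_insert_of_notMem, ih (by omega)]
    simp [mem_permPrefix]

/-- A prefix of a random order is a uniform `k`-set, because relabelling the elements carries any
`k`-set to any other. -/
theorem unifProb_permPrefix {k : ℕ} (hk : k ≤ n) (P : Finset (Fin n) → Prop) [DecidablePred P] :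
    unifProb (fun σ : Equiv.Perm (Fin n) => P (permPrefix σ k)) =
      (((Finset.powersetCard k Finset.univ).filter P).card : ℝ) / n.choose k := by
  have h := unifProb_comp (A := Equiv.Perm (Fin n)) (B := {X : Finset (Fin n) // X.card = k})
    (fun σ => ⟨permPrefix σ k, card_permPrefix σ hk⟩) (by
      rintro ⟨X, hX⟩ ⟨Y, hY⟩
      have e : {x // x ∈ X} ≃ {x // x ∈ Y} := Finset.equivOfCardEq (hX.trans hY.symm)
      refine ⟨⟨fun σ => e.extendSubtype.symm.trans σ, fun σ => e.extendSubtype.trans σ,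
        fun σ => by ext; simp, fun σ => by ext; simp⟩, fun σ hσ => ?_⟩
      simp only [Subtype.mk.injEq] at hσ
      simp only [Equiv.coe_fn_mk, Subtype.mk.injEq, permPrefix_trans, hσ]
      refine Finset.eq_of_subset_of_card_le ?_ (by rw [Finset.card_map]; omega)
      intro x hx
      obtain ⟨y, hy, rfl⟩ := Finset.mem_map.1 hx
      exact e.extendSubtype_mem y hy) (fun X => P X.1)
  rw [h, unifProb_eq_card_filter]
  congr 2
  · rw [← Finset.card_map (Function.Embedding.subtype _)]
    congr 1
    ext X
    simp only [Finset.mem_map, Finset.mem_filter, Finset.mem_univ, true_and,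
      Function.Embedding.subtype_apply, Finset.mem_powersetCard, Finset.subset_univ]
    constructor
    · rintro ⟨X, h, rfl⟩; exact ⟨X.2, h⟩
    · rintro ⟨h, h'⟩; exact ⟨⟨X, h⟩, h', rfl⟩
  · rw [Fintype.card_finset_len, Fintype.card_fin]

namespace Matroid

/-- The circuit `C` of `M` appears first when the elements of `M` are added in the order in which
they occur in the permutation `σ` of the ambient type. -/
def IsFirstCircuitPerm (M : Matroid (Fin n)) (σ : Equiv.Perm (Fin n)) (C : Set (Fin n)) : Prop :=
  M.IsCircuit C ∧ ∃ k : ℕ, M.Indep (M.E ∩ permPrefix σ k) ∧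
    ¬ M.Indep (M.E ∩ permPrefix σ (k + 1)) ∧ C ⊆ permPrefix σ (k + 1)

theorem Ordering.coe_apply_symm {M : Matroid (Fin n)} (π : M.Ordering) {x : Fin n}
    (hx : x ∈ M.E) : (π (π.symm ⟨x, hx⟩) : Fin n) = x := by
  rw [Equiv.apply_symm_apply]

/-- `π` lists the elements of `M` in the order in which they occur in `σ`. -/
def Sorts (M : Matroid (Fin n)) (σ : Equiv.Perm (Fin n)) (π : M.Ordering) : Prop :=
  StrictMono fun i => σ (π i)

theorem exists_sorts (M : Matroid (Fin n)) (σ : Equiv.Perm (Fin n)) : ∃ π, M.Sorts σ π := by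
  classical
  let T : Finset (Fin n) := Finset.univ.filter fun y => σ.symm y ∈ M.E
  let e : {y // y ∈ T} ≃ M.E := σ.symm.subtypeEquiv fun y => by simp [T]
  have hc : T.card = Nat.card M.E := by
    rw [← Nat.card_congr e, Nat.card_eq_fintype_card, Fintype.card_coe]
  refine ⟨(T.orderIsoOfFin hc).toEquiv.trans e, fun i j hij => ?_⟩
  have h := (T.orderIsoOfFin hc).strictMono hij
  have he : ∀ y, σ (e y) = y := fun y => σ.apply_symm_apply y
  change σ (e _) < σ (e _)
  rw [he, he]
  exact h

theorem Sorts.unique {M : Matroid (Fin n)} {σ : Equiv.Perm (Fin n)} {π π' : M.Ordering}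
    (h : M.Sorts σ π) (h' : M.Sorts σ π') : π = π' := by
  have hr : ∀ ρ : M.Ordering, Set.range (fun i => σ (ρ i)) = σ '' M.E := by
    intro ρ
    ext y
    constructor
    · rintro ⟨i, rfl⟩; exact ⟨_, (ρ i).2, rfl⟩
    · rintro ⟨x, hx, rfl⟩; exact ⟨ρ.symm ⟨x, hx⟩, congrArg σ (ρ.coe_apply_symm hx)⟩
  have := (StrictMono.range_inj h h').1 ((hr π).trans (hr π').symm)
  exact Equiv.ext fun i => Subtype.ext (σ.injective (congrFun this i))

theorem Sorts.isFirstCircuit_iff {M : Matroid (Fin n)} {σ : Equiv.Perm (Fin n)} {π : M.Ordering}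
    (h : M.Sorts σ π) (C : Set (Fin n)) : M.IsFirstCircuitPerm σ C ↔ M.IsFirstCircuit π C := by
  have key : ∀ i : Fin (Nat.card M.E),
      M.E ∩ permPrefix σ (σ (π i)) = M.firstElements π i ∧
      M.E ∩ permPrefix σ (σ (π i) + 1) = M.firstElements π (i + 1) := by
    intro i
    constructor <;> ext x <;>
      simp only [firstElements, Set.mem_inter_iff, Finset.mem_coe, mem_permPrefix,
        Set.mem_ofPred_eq, Nat.lt_succ_iff]
    · constructor
      · rintro ⟨hx, hlt⟩
        refine ⟨π.symm ⟨x, hx⟩, ?_, π.coe_apply_symm hx⟩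
        exact h.lt_iff_lt.1 (by rw [π.coe_apply_symm hx]; exact hlt)
      · rintro ⟨j, hj, rfl⟩
        exact ⟨(π j).2, h hj⟩
    · constructor
      · rintro ⟨hx, hlt⟩
        refine ⟨π.symm ⟨x, hx⟩, ?_, π.coe_apply_symm hx⟩
        exact h.le_iff_le.1 (by rw [π.coe_apply_symm hx]; exact hlt)
      · rintro ⟨j, hj, rfl⟩
        exact ⟨(π j).2, h.monotone hj⟩
  constructor
  · rintro ⟨hC, k, h1, h2, h3⟩
    have hkn : k < n := by
      by_contra hk
      rw [permPrefix_of_le σ (by omega)] at h1 h2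
      exact h2 h1
    -- Independence can only be lost at an element of `M`, so this position of `σ` corresponds to an
    -- index of `π`.
    have hE : σ.symm ⟨k, hkn⟩ ∈ M.E := by
      by_contra hE
      rw [permPrefix_succ σ hkn, Finset.coe_insert, Set.inter_insert_of_notMem hE] at h2
      exact h2 h1
    obtain ⟨i, hi⟩ := π.surjective ⟨_, hE⟩
    have hk : (σ (π i) : ℕ) = k := by rw [hi]; simp
    obtain ⟨k1, k2⟩ := key i
    rw [hk] at k1 k2
    refine ⟨hC, i, k1 ▸ h1, k2 ▸ h2, k2 ▸ Set.subset_inter hC.subset_ground h3⟩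
  · rintro ⟨hC, j, h1, h2, h3⟩
    have hj : j < Nat.card M.E := by
      by_contra hj
      have : M.firstElements π (j + 1) = M.firstElements π j := by
        ext x
        simp only [firstElements, Set.mem_ofPred_eq]
        constructor <;> rintro ⟨i, -, h⟩ <;> exact ⟨i, by omega, h⟩
      exact h2 (this ▸ h1)
    obtain ⟨k1, k2⟩ := key ⟨j, hj⟩
    refine ⟨hC, _, k1.symm ▸ h1, k2.symm ▸ h2, ?_⟩
    exact (k2.symm ▸ h3 : C ⊆ M.E ∩ _).trans Set.inter_subset_right

/-- A uniform permutation of the ambient type induces a uniform order on the ground set. One sample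
space thus serves all restrictions of `M` at once. -/
theorem unifProb_ordering (M : Matroid (Fin n)) (Q : Set (Fin n) → Prop) :
    unifProb (fun π : M.Ordering => ∃ C, M.IsFirstCircuit π C ∧ Q C) =
      unifProb (fun σ : Equiv.Perm (Fin n) => ∃ C, M.IsFirstCircuitPerm σ C ∧ Q C) := by
  choose φ hφ using M.exists_sorts
  rw [← unifProb_comp (A := Equiv.Perm (Fin n)) φ]
  · congr 1
    ext σ
    simp only [(hφ σ).isFirstCircuit_iff]
  · intro π π'
    classical
    let g : Equiv.Perm (Fin n) := Equiv.Perm.ofSubtype (p := (· ∈ M.E)) (π.symm.trans π')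
    have hg : ∀ i, g (π i) = π' i := by
      intro i
      rw [Equiv.Perm.ofSubtype_apply_coe, Equiv.trans_apply, Equiv.symm_apply_apply]
    refine ⟨⟨fun σ => g.symm.trans σ, fun σ => g.trans σ,
        fun σ => by ext; simp, fun σ => by ext; simp⟩, fun σ hσ => ?_⟩
    refine (hφ _).unique fun i j hij => ?_
    have h := hφ σ hij
    have hg' : ∀ i, g.symm (π' i) = π i := fun i => by rw [← hg, Equiv.symm_apply_apply]
    change σ (g.symm _) < σ (g.symm _)
    rw [hg', hg']
    rwa [hσ] at h

theorem circuitMass_eq (M : Matroid (Fin n)) (S : Finset (Fin n)) :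
    M.circuitMass S = unifProb fun σ : Equiv.Perm (Fin n) =>
      ∃ C, M.IsFirstCircuitPerm σ C ∧ C ⊆ (S : Set (Fin n)) :=
  M.unifProb_ordering _

theorem hittingProb_eq (M : Matroid (Fin n)) (T : Finset (Fin n)) :
    M.hittingProb T = unifProb fun σ : Equiv.Perm (Fin n) =>
      ∃ C, M.IsFirstCircuitPerm σ C ∧ ((T : Set (Fin n)) ∩ C).Nonempty :=
  M.unifProb_ordering _

theorem IsFirstCircuitPerm.restrict {M : Matroid (Fin n)} {σ : Equiv.Perm (Fin n)}
    {C S : Set (Fin n)} (h : M.IsFirstCircuitPerm σ C) (hC : C ⊆ S) (hS : S ⊆ M.E) :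
    (M.restrict S).IsFirstCircuitPerm σ C := by
  obtain ⟨hC', k, h1, h2, h3⟩ := h
  refine ⟨(restrict_isCircuit_iff hS).2 ⟨hC', hC⟩, k, ?_, ?_, h3⟩
  · rw [restrict_indep_iff]
    exact ⟨h1.subset (Set.inter_subset_inter_left _ hS), Set.inter_subset_left⟩
  · rw [restrict_indep_iff]
    exact fun h => hC'.not_indep (h.1.subset (Set.subset_inter hC h3))

/-- A first circuit inside `S` either avoids `T` or is also the first circuit of `M|S` and meets
`T`. So the circuit mass lost by deleting `T` bounds the hitting probability from below. -/
theorem circuitMass_le_add (M : Matroid (Fin n)) {S T : Finset (Fin n)} (hS : (S : Set (Fin n)) ⊆ M.E) :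
    M.circuitMass S ≤ M.circuitMass (S \ T) + (M.restrict (S : Set (Fin n))).hittingProb T := by
  rw [circuitMass_eq, circuitMass_eq, hittingProb_eq]
  refine (unifProb_mono ?_).trans (unifProb_or_le _ _)
  rintro σ ⟨C, hC, hCS⟩
  by_cases hT : ((T : Set (Fin n)) ∩ C).Nonempty
  · exact Or.inr ⟨C, hC.restrict hCS hS, hT⟩
  · refine Or.inl ⟨C, hC, fun x hx => ?_⟩
    rw [Finset.coe_sdiff]
    exact ⟨hCS hx, fun hxT => hT ⟨x, hxT, hx⟩⟩

theorem exists_isFirstCircuitPerm {M : Matroid (Fin n)} (h : ¬ M.Indep M.E)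
    (σ : Equiv.Perm (Fin n)) : ∃ C, M.IsFirstCircuitPerm σ C := by
  classical
  have hex : ∃ k, ¬ M.Indep (M.E ∩ permPrefix σ k) :=
    ⟨n, by rwa [permPrefix_of_le σ le_rfl, Finset.coe_univ, Set.inter_univ]⟩
  obtain ⟨k, hk, hmin⟩ : ∃ k, ¬ M.Indep (M.E ∩ permPrefix σ k) ∧
      ∀ l < k, M.Indep (M.E ∩ permPrefix σ l) :=
    ⟨Nat.find hex, Nat.find_spec hex, fun l hl => not_not.1 (Nat.find_min hex hl)⟩
  cases k with
  | zero => simp [permPrefix_zero] at hk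
  | succ k =>
    obtain ⟨C, hC, hC'⟩ := ((not_indep_iff Set.inter_subset_left).1 hk).exists_isCircuit_subset
    exact ⟨C, hC', k, hmin k (by omega), hk, hC.trans Set.inter_subset_right⟩

theorem circuitMass_eq_one {M : Matroid (Fin n)} (h : ¬ M.Indep M.E) {R : Finset (Fin n)}
    (hR : M.E ⊆ R) : M.circuitMass R = 1 := by
  rw [circuitMass_eq]
  refine unifProb_of_forall fun σ => ?_
  obtain ⟨C, hC⟩ := exists_isFirstCircuitPerm h σ
  exact ⟨C, hC, hC.1.subset_ground.trans hR⟩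

theorem circuitMass_eq_zero {M : Matroid (Fin n)} {S : Finset (Fin n)}
    (h : M.Indep (S : Set (Fin n))) : M.circuitMass S = 0 := by
  rw [circuitMass_eq]
  refine unifProb_of_forall_not ?_
  rintro σ ⟨C, hC, hCS⟩
  exact hC.1.not_indep (h.subset hCS)

end Matroid

end Orders

/-! ### Bernoulli random subsets. -/

section Bernoulli

variable {V : Type*}

/-- The expectation of `g X` for a random subset `X` of `S` that contains every element of `S` with
probability `t`, independently. -/
noncomputable def bernoulliAvg (t : ℝ) (S : Finset V) (g : Finset V → ℝ) : ℝ :=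
  ∑ X ∈ S.powerset, t ^ X.card * (1 - t) ^ (S.card - X.card) * g X

theorem bernoulliAvg_one (t : ℝ) (S : Finset V) : bernoulliAvg t S (fun _ => 1) = 1 := by
  simp only [bernoulliAvg, mul_one, Finset.sum_pow_mul_eq_add_pow]
  simp

theorem bernoulliAvg_mono {t : ℝ} (h0 : 0 ≤ t) (h1 : t ≤ 1) {S : Finset V} {g h : Finset V → ℝ}
    (hgh : ∀ X ⊆ S, g X ≤ h X) : bernoulliAvg t S g ≤ bernoulliAvg t S h := by
  have : 0 ≤ 1 - t := by linarith
  refine Finset.sum_le_sum fun X hX => ?_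
  have := hgh X (Finset.mem_powerset.1 hX)
  gcongr

theorem bernoulliAvg_const_mul (t : ℝ) (S : Finset V) (c : ℝ) (g : Finset V → ℝ) :
    bernoulliAvg t S (fun X => c * g X) = c * bernoulliAvg t S g := by
  rw [bernoulliAvg, bernoulliAvg, Finset.mul_sum]
  exact Finset.sum_congr rfl fun _ _ => by ring

theorem bernoulliAvg_one_sub (t : ℝ) (S : Finset V) (g : Finset V → ℝ) :
    bernoulliAvg t S (fun X => 1 - g X) = 1 - bernoulliAvg t S g := by
  have h : bernoulliAvg t S (fun X => 1 - g X) =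
      bernoulliAvg t S (fun _ => 1) - bernoulliAvg t S g := by
    rw [bernoulliAvg, bernoulliAvg, bernoulliAvg, ← Finset.sum_sub_distrib]
    exact Finset.sum_congr rfl fun _ _ => by ring
  rw [h, bernoulliAvg_one]

theorem bernoulliAvg_union [DecidableEq V] (t : ℝ) {A B : Finset V} (hAB : Disjoint A B)
    (g h : Finset V → ℝ) :
    bernoulliAvg t (A ∪ B) (fun X => g (X ∩ A) * h (X ∩ B)) =
      bernoulliAvg t A g * bernoulliAvg t B h := by
  simp only [bernoulliAvg]
  rw [Finset.sum_mul_sum, ← Finset.sum_product']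
  have hd : ∀ {x}, x ∈ A → x ∉ B := fun h => Finset.disjoint_left.1 hAB h
  refine Finset.sum_nbij' (fun X => (X ∩ A, X ∩ B)) (fun p => p.1 ∪ p.2) ?_ ?_ ?_ ?_ ?_
  · intro X _
    simp
  · rintro ⟨Y, Z⟩ hp
    simp only [Finset.mem_product, Finset.mem_powerset] at hp ⊢
    exact Finset.union_subset_union hp.1 hp.2
  · intro X hX
    rw [← Finset.inter_union_distrib_left]
    exact Finset.inter_eq_left.2 (Finset.mem_powerset.1 hX)
  · rintro ⟨Y, Z⟩ hp
    simp only [Finset.mem_product, Finset.mem_powerset] at hp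
    ext x
    · have := @hp.1 x; have := @hp.2 x; have := @hd x
      simp only [Finset.mem_inter, Finset.mem_union]; tauto
    · have := @hp.1 x; have := @hp.2 x; have := @hd x
      simp only [Finset.mem_inter, Finset.mem_union]; tauto
  · intro X hX
    have hX := Finset.mem_powerset.1 hX
    have hcard : X.card = (X ∩ A).card + (X ∩ B).card := by
      rw [← Finset.card_union_of_disjoint, ← Finset.inter_union_distrib_left,
        Finset.inter_eq_left.2 hX]
      exact hAB.mono Finset.inter_subset_right Finset.inter_subset_right
    have hA : (X ∩ A).card ≤ A.card := Finset.card_le_card Finset.inter_subset_right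
    have hB : (X ∩ B).card ≤ B.card := Finset.card_le_card Finset.inter_subset_right
    have hs : (A ∪ B).card - X.card = (A.card - (X ∩ A).card) + (B.card - (X ∩ B).card) := by
      rw [Finset.card_union_of_disjoint hAB]; omega
    dsimp only
    rw [hs, hcard, pow_add, pow_add]
    ring

/-- The traces of a Bernoulli set on disjoint sets are independent; the elements outside both sets
are averaged away. -/
theorem bernoulliAvg_univ_mul [Fintype V] [DecidableEq V] (t : ℝ) {A B : Finset V}
    (hAB : Disjoint A B) (g h : Finset V → ℝ) :
    bernoulliAvg t Finset.univ (fun X => g (X ∩ A) * h (X ∩ B)) =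
      bernoulliAvg t A g * bernoulliAvg t B h := by
  have e1 := bernoulliAvg_union t (disjoint_compl_right (a := A)) g (fun X => h (X ∩ B))
  have hB : B ⊆ Aᶜ := fun x hx => Finset.mem_compl.2 fun h => Finset.disjoint_left.1 hAB h hx
  have e2 := bernoulliAvg_union t (Finset.disjoint_sdiff (s := B) (t := Aᶜ)) h (fun _ => 1)
  rw [Finset.union_sdiff_of_subset hB, bernoulliAvg_one, mul_one] at e2
  simp only [mul_one] at e2
  rw [Finset.union_compl, e2] at e1
  simpa only [Finset.inter_assoc, Finset.inter_eq_right.2 hB] using e1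

theorem bernoulliAvg_eq_sum_card (t : ℝ) (S : Finset V) (g : Finset V → ℝ) :
    bernoulliAvg t S g = ∑ k ∈ Finset.range (S.card + 1),
      t ^ k * (1 - t) ^ (S.card - k) * ∑ X ∈ S.powersetCard k, g X := by
  rw [bernoulliAvg, Finset.sum_powerset]
  refine Finset.sum_congr rfl fun k _ => ?_
  rw [Finset.mul_sum]
  refine Finset.sum_congr rfl fun X hX => ?_
  rw [(Finset.mem_powersetCard.1 hX).2]

theorem bernoulliAvg_card (t : ℝ) (S : Finset V) (f : ℕ → ℝ) :
    bernoulliAvg t S (fun X => f X.card) = ∑ k ∈ Finset.range (S.card + 1),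
      t ^ k * (1 - t) ^ (S.card - k) * (S.card.choose k * f k) := by
  rw [bernoulliAvg_eq_sum_card]
  refine Finset.sum_congr rfl fun k _ => ?_
  rw [Finset.sum_congr rfl (g := fun _ => f k)
    fun X hX => by rw [(Finset.mem_powersetCard.1 hX).2]]
  simp [Finset.card_powersetCard]

theorem bernoulliAvg_variance (t : ℝ) (S : Finset V) :
    bernoulliAvg t S (fun X => (S.card * t - X.card) ^ 2) = S.card * t * (1 - t) := by
  rw [bernoulliAvg_card t S (fun k => (S.card * t - k) ^ 2)]
  -- The weights of the binomial size are the Bernstein polynomials evaluated at `t`.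
  have := congrArg (Polynomial.eval t) (bernsteinPolynomial.variance ℝ S.card)
  simp only [Polynomial.eval_finsetSum, bernsteinPolynomial, nsmul_eq_mul, Polynomial.eval_mul,
    Polynomial.eval_pow, Polynomial.eval_sub, Polynomial.eval_natCast, Polynomial.eval_X,
    Polynomial.eval_one] at this
  rw [← this]
  exact Finset.sum_congr rfl fun _ _ => by ring

theorem bernoulliAvg_chebyshev {t : ℝ} (h0 : 0 ≤ t) (h1 : t ≤ 1) (S : Finset V) (P : ℕ → Prop)
    [DecidablePred P] {r : ℝ} (hr : 0 < r) (hP : ∀ k, P k → r ≤ |S.card * t - k|) :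
    bernoulliAvg t S (fun X => if P X.card then 1 else 0) ≤ S.card * t / r ^ 2 := by
  rw [le_div_iff₀ (by positivity), mul_comm, ← bernoulliAvg_const_mul]
  calc bernoulliAvg t S (fun X => r ^ 2 * if P X.card then 1 else 0)
      ≤ bernoulliAvg t S (fun X => (S.card * t - X.card) ^ 2) := by
        refine bernoulliAvg_mono h0 h1 fun X _ => ?_
        split_ifs with h
        · rw [mul_one, ← sq_abs (_ - _)]
          gcongr
          exact hP _ h
        · rw [mul_zero]; positivity
    _ = S.card * t * (1 - t) := bernoulliAvg_variance t S
    _ ≤ S.card * t := by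
        refine mul_le_of_le_one_right (by positivity) (by linarith)

/-- Prefixes of random orders are at least as good as Bernoulli random subsets. -/
theorem bernoulliAvg_le_unifProb {n : ℕ} {t : ℝ} (h0 : 0 ≤ t) (h1 : t ≤ 1)
    (G : Finset (Fin n) → Prop) [DecidablePred G] (F : Equiv.Perm (Fin n) → Prop)
    (h : ∀ σ k, G (permPrefix σ k) → F σ) :
    bernoulliAvg t Finset.univ (fun X => if G X then 1 else 0) ≤ unifProb F := by
  have h1' : 0 ≤ 1 - t := by linarith
  have hone := bernoulliAvg_card t (Finset.univ : Finset (Fin n)) (fun _ => 1)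
  rw [bernoulliAvg_one] at hone
  refine le_trans ?_ ((congrArg (unifProb F * ·) hone).symm.trans (mul_one _)).le
  rw [bernoulliAvg_eq_sum_card, Finset.mul_sum]
  refine Finset.sum_le_sum fun k hk => ?_
  have hkn : k ≤ n := by simpa [Nat.lt_succ_iff] using hk
  have hc : (0 : ℝ) < n.choose k := by exact_mod_cast Nat.choose_pos hkn
  -- Conditioned on having size `k`, the Bernoulli set is distributed like the prefix of length `k`.
  have hle : unifProb (fun σ : Equiv.Perm (Fin n) => G (permPrefix σ k)) ≤ unifProb F :=
    unifProb_mono fun σ => h σ k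
  rw [unifProb_permPrefix hkn, div_le_iff₀ hc] at hle
  rw [Finset.sum_boole]
  simp only [Finset.card_univ, Fintype.card_fin, mul_one]
  calc _ ≤ t ^ k * (1 - t) ^ (n - k) * (unifProb F * n.choose k) := by gcongr
    _ = _ := by ring

/-- The law of a Bernoulli random subset changes continuously with the angle `θ`, where
`sin θ ^ 2` is the probability with which an element is taken. -/
theorem abs_bernoulliAvg_sub_le (S : Finset V) {g : Finset V → ℝ} (hg0 : ∀ X, 0 ≤ g X)
    (hg1 : ∀ X, g X ≤ 1) (a b : ℝ) :
    |bernoulliAvg (Real.sin a ^ 2) S g - bernoulliAvg (Real.sin b ^ 2) S g| ≤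
      2 * √S.card * |a - b| := by
  -- The `u θ` are unit vectors whose squared entries are the weights, with inner products `cos (θ -
  -- φ) ^ |S|`. Factoring `u a ^ 2 - u b ^ 2` and applying Cauchy–Schwarz reduces the claim to `cos
  -- x ≥ 1 - x ^ 2 / 2` and Bernoulli's inequality.
  let u : ℝ → Finset V → ℝ := fun θ X => Real.sin θ ^ X.card * Real.cos θ ^ (S.card - X.card)
  have hu : ∀ θ, bernoulliAvg (Real.sin θ ^ 2) S g = ∑ X ∈ S.powerset, u θ X ^ 2 * g X := by
    intro θ
    refine Finset.sum_congr rfl fun X _ => ?_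
    rw [← Real.cos_sq']
    simp only [u]
    ring
  have huv : ∀ θ φ, ∑ X ∈ S.powerset, u θ X * u φ X = Real.cos (θ - φ) ^ S.card := by
    intro θ φ
    rw [Real.cos_sub, add_comm, ← Finset.sum_pow_mul_eq_add_pow]
    refine Finset.sum_congr rfl fun X _ => ?_
    simp only [u, mul_pow]
    ring
  have huu : ∀ θ, ∑ X ∈ S.powerset, u θ X ^ 2 = 1 := by
    intro θ
    have := huv θ θ
    simpa [sq] using this
  have hs1 : ∑ X ∈ S.powerset, (u a X - u b X) ^ 2 = 2 - 2 * Real.cos (a - b) ^ S.card := by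
    simp only [sub_sq, Finset.sum_add_distrib, Finset.sum_sub_distrib, huu, mul_assoc,
      ← Finset.mul_sum, huv]
    ring
  have hs2 : ∑ X ∈ S.powerset, (u a X + u b X) ^ 2 = 2 + 2 * Real.cos (a - b) ^ S.card := by
    simp only [add_sq, Finset.sum_add_distrib, huu, mul_assoc, ← Finset.mul_sum, huv]
    ring
  have hcos : 1 - S.card * ((a - b) ^ 2 / 2) ≤ Real.cos (a - b) ^ S.card := by
    have h1 := one_add_mul_le_pow (a := Real.cos (a - b) - 1)
      (by linarith [Real.neg_one_le_cos (a - b)]) S.card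
    rw [add_sub_cancel] at h1
    have h2 := Real.one_sub_sq_div_two_le_cos (x := a - b)
    have h3 : (S.card : ℝ) * (1 - (a - b) ^ 2 / 2) ≤ S.card * Real.cos (a - b) := by gcongr
    linarith
  have hcos1 : Real.cos (a - b) ^ S.card ≤ 1 := by
    refine (le_abs_self _).trans ?_
    rw [abs_pow]
    exact pow_le_one₀ (abs_nonneg _) (Real.abs_cos_le_one _)
  have hCS := Finset.sum_mul_sq_le_sq_mul_sq S.powerset (fun X => |u a X - u b X|)
    (fun X => |u a X + u b X|)
  simp only [sq_abs, hs1, hs2] at hCS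
  have hle : |∑ X ∈ S.powerset, u a X ^ 2 * g X - ∑ X ∈ S.powerset, u b X ^ 2 * g X| ≤
      ∑ X ∈ S.powerset, |u a X - u b X| * |u a X + u b X| := by
    rw [← Finset.sum_sub_distrib]
    refine (Finset.abs_sum_le_sum_abs _ _).trans (Finset.sum_le_sum fun X _ => ?_)
    rw [← abs_mul, show u a X ^ 2 * g X - u b X ^ 2 * g X =
      ((u a X - u b X) * (u a X + u b X)) * g X by ring, abs_mul, abs_of_nonneg (hg0 X)]
    exact mul_le_of_le_one_right (abs_nonneg _) (hg1 X)
  rw [hu, hu]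
  refine hle.trans (abs_le_of_sq_le_sq' ?_ (by positivity)).2
  refine hCS.trans ?_
  rw [mul_pow, mul_pow, Real.sq_sqrt (by positivity), sq_abs]
  nlinarith [mul_nonneg (Nat.cast_nonneg (α := ℝ) S.card) (sq_nonneg (a - b))]

end Bernoulli

namespace Matroid

/-! ### Counting independent subsets, and the threshold `α`. -/

section Alpha

open Classical in
/-- The number of independent `k`-element subsets of `S`. -/
noncomputable def indepCount {V : Type*} (M : Matroid V) (S : Finset V) (k : ℕ) : ℕ :=
  ((S.powersetCard k).filter fun X : Finset V => M.Indep (X : Set V)).card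

variable {V : Type*} (M : Matroid V) (S : Finset V)

theorem unifProb_indep_eq (k : ℕ) :
    unifProb (Ω := {T : Finset V // T ⊆ S ∧ T.card = k}) (fun T => M.Indep (T.1 : Set V)) =
      M.indepCount S k / S.card.choose k := by
  classical
  have e : {T : Finset V // T ⊆ S ∧ T.card = k} ≃ {T // T ∈ S.powersetCard k} :=
    Equiv.subtypeEquivRight fun T => Finset.mem_powersetCard.symm
  have e' : {T : {T : Finset V // T ⊆ S ∧ T.card = k} // M.Indep (T.1 : Set V)} ≃
      {T // T ∈ (S.powersetCard k).filter fun X : Finset V => M.Indep (X : Set V)} :=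
    (Equiv.subtypeSubtypeEquivSubtypeInter (fun T : Finset V => T ⊆ S ∧ T.card = k)
      (fun T => M.Indep (T : Set V))).trans (Equiv.subtypeEquivRight fun T => by
        simp [Finset.mem_powersetCard])
  rw [unifProb, Nat.card_congr e, Nat.card_congr e', Nat.card_eq_fintype_card,
    Nat.card_eq_fintype_card, Fintype.card_coe, Fintype.card_coe, Finset.card_powersetCard,
    indepCount]

/-- Double counting of pairs `X ⊂ Y` with `|X| = k` and `|Y| = k + 1`: all `k`-subsets of an
independent `Y` are independent. Hence the proportion of independent `k`-sets does not increase with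
`k`. -/
theorem indepCount_succ_mul_le (k : ℕ) :
    M.indepCount S (k + 1) * (k + 1) ≤ M.indepCount S k * (S.card - k) := by
  classical
  unfold indepCount
  refine Finset.card_mul_le_card_mul (fun Y X : Finset V => X ⊆ Y) ?_ ?_
  · intro Y hY
    obtain ⟨hY, hYI⟩ := Finset.mem_filter.1 hY
    obtain ⟨hYS, hYc⟩ := Finset.mem_powersetCard.1 hY
    rw [← hYc, ← Finset.card_image_of_injOn (s := Y) (f := fun x => Y.erase x)]
    · refine Finset.card_le_card fun X hX => ?_
      obtain ⟨x, hx, rfl⟩ := Finset.mem_image.1 hX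
      simp only [Finset.mem_bipartiteAbove, Finset.mem_filter, Finset.mem_powersetCard]
      refine ⟨⟨⟨(Finset.erase_subset _ _).trans hYS, ?_⟩, ?_⟩, Finset.erase_subset _ _⟩
      · rw [Finset.card_erase_of_mem hx]; omega
      · exact hYI.subset (by exact_mod_cast Finset.erase_subset x Y)
    · intro x hx y hy h
      by_contra hne
      have : x ∈ Y.erase y := Finset.mem_erase.2 ⟨hne, hx⟩
      dsimp only at h
      rw [← h] at this
      exact (Finset.mem_erase.1 this).1 rfl
  · intro X hX
    obtain ⟨hX, -⟩ := Finset.mem_filter.1 hX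
    obtain ⟨hXS, hXc⟩ := Finset.mem_powersetCard.1 hX
    have : S.card - k = (S \ X).card := by rw [Finset.card_sdiff_of_subset hXS, hXc]
    rw [this]
    refine (Finset.card_le_card (t := (S \ X).image fun x => insert x X) ?_).trans
      Finset.card_image_le
    intro Y hY
    simp only [Finset.mem_bipartiteBelow, Finset.mem_filter, Finset.mem_powersetCard] at hY
    obtain ⟨⟨⟨hYS, hYc⟩, -⟩, hXY⟩ := hY
    obtain ⟨x, hx⟩ := Finset.card_eq_one.1
      (show (Y \ X).card = 1 by rw [Finset.card_sdiff_of_subset hXY]; omega)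
    have hxm : x ∈ Y \ X := by rw [hx]; exact Finset.mem_singleton_self x
    obtain ⟨hxY, hxX⟩ := Finset.mem_sdiff.1 hxm
    refine Finset.mem_image.2 ⟨x, Finset.mem_sdiff.2 ⟨hYS hxY, hxX⟩, ?_⟩
    rw [← Finset.sdiff_union_of_subset hXY, hx, Finset.insert_eq]

theorem two_mul_indepCount_alpha_le :
    2 * M.indepCount S (M.alpha S) ≤ S.card.choose (M.alpha S) := by
  have hne : {k : ℕ | unifProb (Ω := {T : Finset V // T ⊆ S ∧ T.card = k})
      (fun T => M.Indep (T.1 : Set V)) ≤ 1 / 2}.Nonempty := by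
    -- No subset has this size and `0 / 0 = 0`, so the infimum defining `α` is attained.
    refine ⟨S.card + 1, ?_⟩
    rw [Set.mem_ofPred_eq, unifProb_indep_eq]
    simp
  have h := Nat.sInf_mem hne
  change unifProb (Ω := {T : Finset V // T ⊆ S ∧ T.card = M.alpha S})
      (fun T => M.Indep (T.1 : Set V)) ≤ 1 / 2 at h
  rw [unifProb_indep_eq] at h
  rcases (S.card.choose (M.alpha S)).eq_zero_or_pos with h0 | h0
  · have := Finset.powersetCard_eq_empty.2 (Nat.choose_eq_zero_iff.1 h0)
    simp [indepCount, this]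
  · rw [div_le_div_iff₀ (by exact_mod_cast h0) two_pos, one_mul, mul_comm] at h
    exact_mod_cast h

theorem two_mul_indepCount_le {k : ℕ} (hk : M.alpha S ≤ k) :
    2 * M.indepCount S k ≤ S.card.choose k := by
  induction k, hk using Nat.le_induction with
  | base => exact M.two_mul_indepCount_alpha_le S
  | succ k _ ih =>
    refine Nat.le_of_mul_le_mul_right (c := k + 1) ?_ (Nat.succ_pos k)
    calc 2 * M.indepCount S (k + 1) * (k + 1) = 2 * (M.indepCount S (k + 1) * (k + 1)) := by ring
      _ ≤ 2 * (M.indepCount S k * (S.card - k)) := by exact Nat.mul_le_mul_left 2 (M.indepCount_succ_mul_le S k)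
      _ = 2 * M.indepCount S k * (S.card - k) := by ring
      _ ≤ S.card.choose k * (S.card - k) := by gcongr
      _ = _ := (Nat.choose_succ_right_eq _ _).symm

theorem choose_le_two_mul_indepCount {k : ℕ} (hk : k < M.alpha S) :
    S.card.choose k ≤ 2 * M.indepCount S k := by
  have h := Nat.notMem_of_lt_sInf hk
  rw [Set.mem_ofPred_eq, unifProb_indep_eq, not_le] at h
  rcases (S.card.choose k).eq_zero_or_pos with h0 | h0
  · omega
  · rw [div_lt_div_iff₀ two_pos (by exact_mod_cast h0), one_mul, mul_comm] at h
    exact_mod_cast h.le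

theorem alpha_le_card (h : ¬ M.Indep (S : Set V)) : M.alpha S ≤ S.card := by
  by_contra hlt
  have := M.choose_le_two_mul_indepCount S (not_le.1 hlt)
  simp [indepCount, Finset.powersetCard_self, Finset.filter_singleton, h] at this

theorem alpha_pos : 0 < M.alpha S := by
  by_contra h0
  have := M.two_mul_indepCount_alpha_le S
  simp [indepCount, Nat.eq_zero_of_not_pos h0, Finset.filter_singleton] at this

end Alpha

/-! ### Dependence probabilities and dependence angles. -/

section Dependence

open Classical in
/-- The probability that a random subset of `S`, containing every element with probability `t`
independently, is dependent. -/
noncomputable def depProb {V : Type*} (M : Matroid V) (S : Finset V) (t : ℝ) : ℝ :=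
  bernoulliAvg t S fun X => if M.Indep (X : Set V) then 0 else 1

open Classical in
theorem one_sub_depProb {V : Type*} (M : Matroid V) (S : Finset V) (t : ℝ) :
    1 - M.depProb S t = bernoulliAvg t S fun X => if M.Indep (X : Set V) then 1 else 0 := by
  rw [depProb, ← bernoulliAvg_one_sub]
  congr 1
  ext X
  split_ifs <;> simp

variable {V : Type*} {M : Matroid V} {S : Finset V}

/-- The mean size is `4 * α`, so by Chebyshev the size is below `α` with probability at most `4/9`.
Otherwise dependence has conditional probability at least `1/2`, and `5/18 ≥ 1/4`. -/
theorem one_fourth_le_depProb {t : ℝ} (h1 : t ≤ 1)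
    (ht : S.card * t = 4 * M.alpha S) : 1 / 4 ≤ M.depProb S t := by
  classical
  have ha : (1 : ℝ) ≤ M.alpha S := by exact_mod_cast M.alpha_pos S
  have h0 : 0 ≤ t := by
    by_contra h
    nlinarith [(Nat.cast_nonneg S.card : (0 : ℝ) ≤ S.card)]
  have h1' : 0 ≤ 1 - t := by linarith
  have hcheb := bernoulliAvg_chebyshev h0 h1 S (fun k => k < M.alpha S) (r := 3 * M.alpha S)
    (by positivity) (fun k hk => by
      have : (k : ℝ) < M.alpha S := by exact_mod_cast hk
      rw [ht]; refine le_trans ?_ (le_abs_self _); linarith)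
  have hb : (S.card * t / (3 * M.alpha S) ^ 2 : ℝ) ≤ 4 / 9 := by
    rw [ht, div_le_div_iff₀ (by positivity) (by norm_num)]
    nlinarith
  have hhalf : 1 / 2 * bernoulliAvg t S (fun X => 1 - if X.card < M.alpha S then 1 else 0) ≤
      M.depProb S t := by
    rw [← bernoulliAvg_const_mul, depProb, bernoulliAvg_eq_sum_card, bernoulliAvg_eq_sum_card]
    refine Finset.sum_le_sum fun k hk => ?_
    refine mul_le_mul_of_nonneg_left ?_ (by positivity)
    rw [Finset.sum_congr rfl (g := fun _ => 1 / 2 * (1 - if k < M.alpha S then (1 : ℝ) else 0))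
      fun X hX => by rw [(Finset.mem_powersetCard.1 hX).2]]
    rw [Finset.sum_const, Finset.card_powersetCard, nsmul_eq_mul]
    split_ifs with h
    · simp only [sub_self, mul_zero]
      exact Finset.sum_nonneg fun X _ => by split_ifs <;> norm_num
    · have hc := M.two_mul_indepCount_le S (not_lt.1 h)
      have hsum : ∑ X ∈ S.powersetCard k, (if M.Indep (X : Set V) then (0 : ℝ) else 1) =
          S.card.choose k - M.indepCount S k := by
        rw [← Finset.card_powersetCard, indepCount, ← Finset.card_filter_add_card_filter_not
          (s := S.powersetCard k) (fun X => M.Indep (X : Set V))]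
        rw [Finset.sum_ite, Finset.sum_const_zero, zero_add, Finset.sum_const]
        push_cast
        simp
      rw [hsum]
      have : (2 * M.indepCount S k : ℝ) ≤ S.card.choose k := by exact_mod_cast hc
      linarith
  rw [bernoulliAvg_one_sub] at hhalf
  linarith

/-- The mean size is at most `α / 8`, so by Chebyshev the size is below `α` with probability at
least `1/2`; independence then has conditional probability at least `1/2`. -/
theorem depProb_le_three_fourths {t : ℝ} (h0 : 0 ≤ t) (h1 : t ≤ 1)
    (ht : S.card * t ≤ M.alpha S / 8) : M.depProb S t ≤ 3 / 4 := by
  classical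
  have ha : (1 : ℝ) ≤ M.alpha S := by exact_mod_cast M.alpha_pos S
  have h1' : 0 ≤ 1 - t := by linarith
  have hcheb := bernoulliAvg_chebyshev h0 h1 S (fun k => M.alpha S ≤ k) (r := 7 / 8 * M.alpha S)
    (by positivity) (fun k hk => by
      have : (M.alpha S : ℝ) ≤ k := by exact_mod_cast hk
      refine le_trans ?_ (neg_le_abs _); linarith)
  have hb : (S.card * t / (7 / 8 * M.alpha S) ^ 2 : ℝ) ≤ 1 / 2 := by
    rw [div_le_div_iff₀ (by positivity) (by norm_num)]
    nlinarith
  have hhalf : 1 / 2 * bernoulliAvg t S (fun X => 1 - if M.alpha S ≤ X.card then 1 else 0) ≤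
      1 - M.depProb S t := by
    rw [← bernoulliAvg_const_mul, one_sub_depProb, bernoulliAvg_eq_sum_card,
      bernoulliAvg_eq_sum_card]
    refine Finset.sum_le_sum fun k hk => ?_
    refine mul_le_mul_of_nonneg_left ?_ (by positivity)
    rw [Finset.sum_congr rfl (g := fun _ => 1 / 2 * (1 - if M.alpha S ≤ k then (1 : ℝ) else 0))
      fun X hX => by rw [(Finset.mem_powersetCard.1 hX).2]]
    rw [Finset.sum_const, Finset.card_powersetCard, nsmul_eq_mul, Finset.sum_boole]
    change _ ≤ (M.indepCount S k : ℝ)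
    split_ifs with h
    · simp
    · have : (S.card.choose k : ℝ) ≤ 2 * M.indepCount S k := by
        exact_mod_cast M.choose_le_two_mul_indepCount S (not_le.1 h)
      linarith
  rw [bernoulliAvg_one_sub] at hhalf
  linarith

theorem abs_depProb_sub_le (M : Matroid V) (S : Finset V) (a b : ℝ) :
    |M.depProb S (Real.sin a ^ 2) - M.depProb S (Real.sin b ^ 2)| ≤ 2 * √S.card * |a - b| := by
  classical
  refine abs_bernoulliAvg_sub_le S ?_ ?_ a b <;> intro X <;> split_ifs <;> norm_num

theorem depProb_zero (M : Matroid V) (S : Finset V) : M.depProb S 0 = 0 := by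
  classical
  refine Finset.sum_eq_zero fun X _ => ?_
  rcases X.eq_empty_or_nonempty with rfl | hX
  · simp
  · rw [zero_pow (Finset.card_pos.2 hX).ne']; simp

theorem depProb_one (hS : ¬ M.Indep (S : Set V)) : M.depProb S 1 = 1 := by
  classical
  rw [depProb, bernoulliAvg, Finset.sum_eq_single_of_mem S (Finset.mem_powerset_self S)]
  · simp [hS]
  · intro X hX hne
    have : X.card < S.card :=
      Finset.card_lt_card ((Finset.mem_powerset.1 hX).ssubset_of_ne hne)
    rw [sub_self, zero_pow (by omega)]
    simp

/-- `θ` is the angle at which dependence of a random subset of `S` first has probability `1/4`. -/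
def IsDependenceAngle (M : Matroid V) (S : Finset V) (θ : ℝ) : Prop :=
  0 ≤ θ ∧ θ ≤ Real.pi / 2 ∧ M.depProb S (Real.sin θ ^ 2) = 1 / 4 ∧
    ∀ φ, 0 ≤ φ → 1 / 4 ≤ M.depProb S (Real.sin φ ^ 2) → θ ≤ φ

/-- The Lipschitz bound gives continuity, so the infimum of the angles with value at least `1/4` is
attained, and the intermediate value theorem gives equality there. Choosing the least angle avoids
any appeal to monotonicity in `t`. -/
theorem exists_isDependenceAngle (hS : ¬ M.Indep (S : Set V)) :
    ∃ θ, M.IsDependenceAngle S θ := by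
  have hpi := Real.pi_pos
  set F : ℝ → ℝ := fun θ => M.depProb S (Real.sin θ ^ 2) with hF
  have hcont : Continuous F := by
    have : LipschitzWith (2 * √S.card).toNNReal F := by
      refine LipschitzWith.of_dist_le_mul fun a b => ?_
      rw [Real.coe_toNNReal _ (by positivity), Real.dist_eq, Real.dist_eq]
      exact M.abs_depProb_sub_le S a b
    exact this.continuous
  have hF0 : F 0 = 0 := by simp [hF, depProb_zero]
  have hF1 : F (Real.pi / 2) = 1 := by simp [hF, depProb_one hS]
  let A : Set ℝ := {θ | 0 ≤ θ ∧ 1 / 4 ≤ F θ}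
  have hA : IsClosed A :=
    (isClosed_le continuous_const continuous_id).inter (isClosed_le continuous_const hcont)
  have hne : A.Nonempty := ⟨Real.pi / 2, by positivity, by rw [hF1]; norm_num⟩
  have hbdd : BddBelow A := ⟨0, fun θ h => h.1⟩
  obtain ⟨h0, h14⟩ := hA.csInf_mem hne hbdd
  refine ⟨sInf A, h0, csInf_le hbdd ⟨by positivity, by rw [hF1]; norm_num⟩, ?_,
    fun φ h h' => csInf_le hbdd ⟨h, h'⟩⟩
  obtain ⟨φ, hφ, hFφ⟩ := intermediate_value_Icc h0 hcont.continuousOn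
    (⟨by rw [hF0]; norm_num, h14⟩ : (1 / 4 : ℝ) ∈ Set.Icc (F 0) (F (sInf A)))
  have : φ = sInf A := le_antisymm hφ.2 (csInf_le hbdd ⟨hφ.1, hFφ.ge⟩)
  rw [← this]
  exact hFφ

theorem card_pos_of_not_indep (hS : ¬ M.Indep (S : Set V)) : 0 < S.card := by
  rw [Finset.card_pos]
  by_contra h
  rw [Finset.not_nonempty_iff_eq_empty] at h
  exact hS (by simp [h])

theorem IsDependenceAngle.le {θ : ℝ} (h : M.IsDependenceAngle S θ) (hS : ¬ M.Indep (S : Set V)) :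
    1 / (8 * √S.card) ≤ θ := by
  obtain ⟨h0, h1, h2, h3⟩ := h
  have hc : (0 : ℝ) < S.card := by exact_mod_cast card_pos_of_not_indep hS
  have := M.abs_depProb_sub_le S θ 0
  rw [h2, Real.sin_zero, zero_pow two_ne_zero, depProb_zero, sub_zero, sub_zero,
    abs_of_nonneg h0, abs_of_pos (by norm_num)] at this
  rw [div_le_iff₀ (by positivity)]
  linarith

/-- At `t = 4 * α / |S|` dependence already has probability `1/4`, so `sin θ ^ 2 ≤ t`-type control
follows from minimality of `θ` and Jordan's inequality `2 / π * x ≤ sin x`. If this `t` exceeds `1`,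
the bound `θ ≤ π / 2` suffices. -/
theorem IsDependenceAngle.sq_mul_card_le {θ : ℝ} (h : M.IsDependenceAngle S θ)
    (hS : ¬ M.Indep (S : Set V)) : θ ^ 2 * S.card ≤ Real.pi ^ 2 * M.alpha S := by
  obtain ⟨h0, h1, h2, h3⟩ := h
  have hpi := Real.pi_pos
  have hc : (0 : ℝ) < S.card := by exact_mod_cast card_pos_of_not_indep hS
  rcases le_or_gt (4 * (M.alpha S : ℝ)) S.card with h4 | h4
  · have ht0 : (0 : ℝ) ≤ 4 * M.alpha S / S.card := by positivity
    have ht1 : 4 * (M.alpha S : ℝ) / S.card ≤ 1 := div_le_one_of_le₀ h4 hc.le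
    have hs1 : √(4 * M.alpha S / S.card) ≤ 1 := Real.sqrt_le_one.2 ht1
    have hsin : Real.sin (Real.arcsin √(4 * M.alpha S / S.card)) = √(4 * M.alpha S / S.card) :=
      Real.sin_arcsin (by linarith [Real.sqrt_nonneg (4 * M.alpha S / S.card : ℝ)]) hs1
    have hsq : Real.sin (Real.arcsin √(4 * M.alpha S / S.card)) ^ 2 = 4 * M.alpha S / S.card := by
      rw [hsin, Real.sq_sqrt ht0]
    have hle := h3 _ (Real.arcsin_nonneg.2 (Real.sqrt_nonneg _))
      (by rw [hsq]; exact one_fourth_le_depProb ht1 (by field_simp))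
    have hj := Real.mul_le_sin (Real.arcsin_nonneg.2 (Real.sqrt_nonneg (4 * M.alpha S / S.card)))
      (Real.arcsin_le_pi_div_two _)
    have hle' : 2 / Real.pi * θ ≤ √(4 * M.alpha S / S.card) := by
      rw [← hsin]; refine le_trans ?_ hj; gcongr
    have := pow_le_pow_left₀ (by positivity) hle' 2
    rw [Real.sq_sqrt ht0, le_div_iff₀ hc, mul_pow, div_pow] at this
    have h5 : (2 : ℝ) ^ 2 / Real.pi ^ 2 * θ ^ 2 * S.card =
      4 * (θ ^ 2 * S.card) / Real.pi ^ 2 := by ring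
    rw [h5, div_le_iff₀ (by positivity)] at this
    linarith
  · calc θ ^ 2 * S.card ≤ (Real.pi / 2) ^ 2 * (4 * M.alpha S) := by gcongr
      _ = _ := by ring

end Dependence

/-! ### Comparing a peeled set with a later one. -/

section Pair

variable {n : ℕ} {M N : Matroid (Fin n)} {S U : Finset (Fin n)}

/-- Here `N` is what remains when `S` is peeled. A prefix dependent on `U` already contains the
first circuit of `N`; if that circuit lay in `S`, the trace of the prefix on `S` would be dependent.
-/
theorem one_sub_depProb_mul_depProb_le (hMN : ∀ X ⊆ N.E, N.Indep X ↔ M.Indep X)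
    (hU : (U : Set (Fin n)) ⊆ N.E) (hSU : Disjoint S U)
    (hq : 1 - (1 / 2 : ℝ) ^ 20 ≤ N.circuitMass S) {t : ℝ} (h0 : 0 ≤ t) (h1 : t ≤ 1) :
    (1 - M.depProb S t) * M.depProb U t ≤ (1 / 2 : ℝ) ^ 20 := by
  classical
  have hle := bernoulliAvg_le_unifProb h0 h1
    (fun X => M.Indep ((X ∩ S : Finset (Fin n)) : Set (Fin n)) ∧
      ¬ M.Indep ((X ∩ U : Finset (Fin n)) : Set (Fin n)))
    (fun σ => ¬ ∃ C, N.IsFirstCircuitPerm σ C ∧ C ⊆ (S : Set (Fin n))) (by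
      rintro σ k ⟨hXS, hXU⟩ ⟨C, ⟨hC, j, hj1, hj2, hj3⟩, hCS⟩
      have hXU' : ¬ N.Indep (N.E ∩ permPrefix σ k) := by
        intro h
        refine hXU ((hMN _ ?_).1 (h.subset ?_)) <;> rw [Finset.coe_inter]
        · exact Set.inter_subset_right.trans hU
        · exact fun x hx => ⟨hU hx.2, hx.1⟩
      have hjk : j + 1 ≤ k := by
        by_contra hlt
        refine hXU' (hj1.subset (Set.inter_subset_inter_right _ ?_))
        exact_mod_cast permPrefix_mono σ (by omega)
      refine hC.not_indep ((hMN _ hC.subset_ground).2 (hXS.subset ?_))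
      intro x hx
      exact Finset.mem_inter.2 ⟨permPrefix_mono σ hjk (hj3 hx), hCS hx⟩)
  rw [unifProb_not, ← circuitMass_eq] at hle
  have hprod := bernoulliAvg_univ_mul t hSU
    (fun X => if M.Indep (X : Set (Fin n)) then (1 : ℝ) else 0)
    (fun X => if M.Indep (X : Set (Fin n)) then (0 : ℝ) else 1)
  rw [← one_sub_depProb, ← depProb] at hprod
  rw [← hprod]
  have heq : ∀ X : Finset (Fin n), ((if M.Indep ((X ∩ S : Finset (Fin n)) : Set (Fin n)) then (1 : ℝ)
      else 0) * if M.Indep ((X ∩ U : Finset (Fin n)) : Set (Fin n)) then (0 : ℝ) else 1) =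
      if M.Indep ((X ∩ S : Finset (Fin n)) : Set (Fin n)) ∧
        ¬ M.Indep ((X ∩ U : Finset (Fin n)) : Set (Fin n)) then 1 else 0 := by
    intro X
    by_cases a : M.Indep ((X ∩ S : Finset (Fin n)) : Set (Fin n)) <;>
      by_cases b : M.Indep ((X ∩ U : Finset (Fin n)) : Set (Fin n)) <;> simp only [a, b] <;> simp
  rw [show (fun X : Finset (Fin n) => _) = _ from funext heq]
  linarith

/-- Were `φ` smaller, `S` would have dependence probability at most `1/4 + 1/2` at `φ`, by
minimality of `θ` or by the Lipschitz bound. The product would be at least `1/16`. -/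
theorem IsDependenceAngle.add_le (hMN : ∀ X ⊆ N.E, N.Indep X ↔ M.Indep X)
    (hU : (U : Set (Fin n)) ⊆ N.E) (hSU : Disjoint S U)
    (hq : 1 - (1 / 2 : ℝ) ^ 20 ≤ N.circuitMass S) (hSi : ¬ M.Indep (S : Set (Fin n))) {θ φ : ℝ}
    (hθ : M.IsDependenceAngle S θ) (hφ : M.IsDependenceAngle U φ) :
    θ + 1 / (4 * √S.card) ≤ φ := by
  have hc : (0 : ℝ) < S.card := by exact_mod_cast card_pos_of_not_indep hSi
  by_contra hlt
  have key := one_sub_depProb_mul_depProb_le hMN hU hSU hq (sq_nonneg (Real.sin φ))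
    (Real.sin_sq_le_one φ)
  have hle : M.depProb S (Real.sin φ ^ 2) ≤ 3 / 4 := by
    rcases lt_or_ge φ θ with h | h
    · by_contra h'
      exact absurd (hθ.2.2.2 φ hφ.1 (by linarith)) (not_le.2 h)
    · have h2 := (abs_le.1 (M.abs_depProb_sub_le S φ θ)).2
      rw [hθ.2.2.1, abs_of_nonneg (by linarith)] at h2
      have h3 : φ - θ < 1 / (4 * √S.card) := by linarith
      rw [lt_div_iff₀ (by positivity)] at h3
      linarith
  rw [hφ.2.2.1] at key
  norm_num at key
  linarith

/-- Otherwise, at `t = 4 * α(U) / |U|`, the set `U` is dependent with probability at least `1/4` and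
`S` independent with probability at least `1/4`. The constant is `32 = 4 * 8`, from the two
Chebyshev estimates. -/
theorem alpha_div_card_le (hMN : ∀ X ⊆ N.E, N.Indep X ↔ M.Indep X)
    (hU : (U : Set (Fin n)) ⊆ N.E) (hSU : Disjoint S U)
    (hq : 1 - (1 / 2 : ℝ) ^ 20 ≤ N.circuitMass S) (hSi : ¬ M.Indep (S : Set (Fin n)))
    (hUi : ¬ M.Indep (U : Set (Fin n))) :
    1 / 32 * ((M.alpha S : ℝ) / S.card) ≤ (M.alpha U : ℝ) / U.card := by
  have hc : (0 : ℝ) < S.card := by exact_mod_cast card_pos_of_not_indep hSi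
  have hc' : (0 : ℝ) < U.card := by exact_mod_cast card_pos_of_not_indep hUi
  have ha : (M.alpha S : ℝ) / S.card ≤ 1 :=
    div_le_one_of_le₀ (by exact_mod_cast M.alpha_le_card S hSi) hc.le
  by_contra hlt
  have h0 : (0 : ℝ) ≤ 4 * (M.alpha U / U.card) := by positivity
  have h1 : (4 : ℝ) * (M.alpha U / U.card) ≤ 1 := by linarith
  have key := one_sub_depProb_mul_depProb_le hMN hU hSU hq h0 h1
  have hdU := one_fourth_le_depProb h1 (by field_simp)
  have hdS : M.depProb S (4 * (M.alpha U / U.card)) ≤ 3 / 4 := by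
    refine depProb_le_three_fourths h0 h1 ?_
    have : (4 : ℝ) * (M.alpha U / U.card) ≤ M.alpha S / S.card / 8 := by linarith
    calc (S.card : ℝ) * (4 * (M.alpha U / U.card)) ≤ S.card * (M.alpha S / S.card / 8) := by gcongr
      _ = _ := by field_simp
  norm_num at key
  nlinarith

end Pair

end Matroid

theorem card_filter_le_mul_le {k : ℕ} (I : Finset (Fin k)) (θ : Fin k → ℝ) {δ : ℝ}
    (h0 : ∀ i ∈ I, δ ≤ θ i) (hstep : ∀ i ∈ I, ∀ j ∈ I, i < j → θ i + δ ≤ θ j) (i : Fin k)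
    (hi : i ∈ I) : ((I.filter (· ≤ i)).card : ℝ) * δ ≤ θ i := by
  induction i using WellFoundedLT.induction with
  | ind i ih =>
    have hins : I.filter (· ≤ i) = insert i (I.filter (· < i)) := by
      ext j
      simp only [Finset.mem_filter, Finset.mem_insert, le_iff_eq_or_lt]
      constructor
      · rintro ⟨h1, h2⟩; tauto
      · rintro (rfl | h) <;> tauto
    rw [hins, Finset.card_insert_of_notMem (by simp)]
    rcases (I.filter (· < i)).eq_empty_or_nonempty with he | hne
    · rw [he]; simpa using h0 i hi
    · set j := (I.filter (· < i)).max' hne with hj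
      obtain ⟨hjI, hji⟩ := Finset.mem_filter.1 ((I.filter (· < i)).max'_mem hne)
      have hsub : I.filter (· < i) ⊆ I.filter (· ≤ j) := fun x hx =>
        Finset.mem_filter.2 ⟨(Finset.mem_filter.1 hx).1, Finset.le_max' _ _ hx⟩
      have heq : I.filter (· < i) = I.filter (· ≤ j) :=
        hsub.antisymm fun x hx => Finset.mem_filter.2
          ⟨(Finset.mem_filter.1 hx).1, (Finset.mem_filter.1 hx).2.trans_lt hji⟩
      have := ih j hji hjI
      rw [heq]
      push_cast
      linarith [hstep j hjI i hi hji]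

namespace Matroid

variable {V : Type*} (M : Matroid V)

theorem peelOff_indep_iff {L : List (Finset V)} {X : Set V} (hX : X ⊆ (M.peelOff L).E) :
    (M.peelOff L).Indep X ↔ M.Indep X := by
  unfold peelOff at *
  rw [delete_indep_iff, and_iff_left]
  exact (Set.subset_sdiff.1 hX).2

theorem mem_peelOff_ground {L : List (Finset V)} {x : V} :
    x ∈ (M.peelOff L).E ↔ x ∈ M.E ∧ ∀ S ∈ L, x ∉ S := by
  simp [peelOff]

end Matroid

/-! ### Bounds for lists of successively optimal sets. -/

section Decomposition

open Matroid

variable {n : ℕ} {M : Matroid (Fin n)} {L : List (Finset (Fin n))}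

/-- Every set of the list is globally optimal in the matroid left over by the previous ones. -/
def IsOptimalPeeling (M : Matroid (Fin n)) (L : List (Finset (Fin n))) : Prop :=
  ∀ i : Fin L.length, (M.peelOff (L.take i)).GloballyOptimal (L.get i)

namespace IsOptimalPeeling

theorem subset_ground (h : IsOptimalPeeling M L) {i j : Fin L.length} (hij : i ≤ j) :
    (L.get j : Set (Fin n)) ⊆ (M.peelOff (L.take i)).E := by
  intro x hx
  have h1 := (h j).1 hx
  rw [mem_peelOff_ground] at h1 ⊢
  exact ⟨h1.1, fun S hS => h1.2 S (List.take_subset_take_left L hij hS)⟩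

theorem disjoint (h : IsOptimalPeeling M L) {i j : Fin L.length} (hij : i < j) :
    Disjoint (L.get i) (L.get j) := by
  rw [Finset.disjoint_left]
  intro x hi hj
  refine ((M.mem_peelOff_ground).1 ((h j).1 hj)).2 _ ?_ hi
  rw [List.mem_take_iff_getElem]
  exact ⟨i, by simp [hij], rfl⟩

theorem not_indep (h : IsOptimalPeeling M L) (i : Fin L.length) :
    ¬ M.Indep (L.get i : Set (Fin n)) := by
  intro hi
  have := (h i).2.1
  rw [circuitMass_eq_zero ((M.peelOff_indep_iff (h i).1).2 hi)] at this
  norm_num at this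

theorem ratio_le (h : IsOptimalPeeling M L) {i j : Fin L.length} (hij : i < j) :
    1 / 32 * ((M.alpha (L.get i) : ℝ) / (L.get i).card) ≤
      (M.alpha (L.get j) : ℝ) / (L.get j).card :=
  alpha_div_card_le (fun _ hX => M.peelOff_indep_iff hX) (h.subset_ground hij.le) (h.disjoint hij)
    (h i).2.1 (h.not_indep i) (h.not_indep j)

/-- The dependence angles of the peeled sets of size at most `B` grow at a linear rate. -/
theorem exists_angles (h : IsOptimalPeeling M L) : ∃ θ : Fin L.length → ℝ,
    (∀ i, M.IsDependenceAngle (L.get i) (θ i)) ∧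
    ∀ (I : Finset (Fin L.length)) (B : ℝ), (∀ i ∈ I, ((L.get i).card : ℝ) ≤ B) → ∀ i ∈ I,
      ((I.filter (· ≤ i)).card : ℝ) * (1 / (8 * √B)) ≤ θ i := by
  choose θ hθ using fun i => exists_isDependenceAngle (h.not_indep i)
  refine ⟨θ, hθ, fun I B hB => card_filter_le_mul_le I θ ?_ ?_⟩
  · intro i hi
    have hc : (0 : ℝ) < (L.get i).card := by exact_mod_cast card_pos_of_not_indep (h.not_indep i)
    refine le_trans ?_ ((hθ i).le (h.not_indep i))
    have := hB i hi
    gcongr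
  · intro i hi j hj hij
    have hc : (0 : ℝ) < (L.get i).card := by exact_mod_cast card_pos_of_not_indep (h.not_indep i)
    refine le_trans ?_ (IsDependenceAngle.add_le (fun _ hX => M.peelOff_indep_iff hX)
      (h.subset_ground hij.le) (h.disjoint hij) (h i).2.1 (h.not_indep i) (hθ i) (hθ j))
    have := hB i hi
    gcongr
    norm_num

/-- The last angle is at most `π / 2`, which gives `4 * π * √B < 13 * √B`. -/
theorem card_le_of_card_le (h : IsOptimalPeeling M L) (I : Finset (Fin L.length)) (B : ℝ)
    (hB : ∀ i ∈ I, ((L.get i).card : ℝ) ≤ B) : (I.card : ℝ) ≤ 13 * √B := by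
  obtain ⟨θ, hθ, hI⟩ := h.exists_angles
  rcases I.eq_empty_or_nonempty with rfl | hne
  · simp
  · have hm := I.max'_mem hne
    have hc : (0 : ℝ) < (L.get (I.max' hne)).card := by
      exact_mod_cast card_pos_of_not_indep (h.not_indep _)
    have hB0 : 0 < B := hc.trans_le (hB _ hm)
    have h1 := (hI I B hB _ hm).trans (hθ _).2.1
    rw [Finset.filter_true_of_mem fun i hi => I.le_max' i hi, mul_one_div,
      div_le_iff₀ (by positivity)] at h1
    nlinarith [Real.pi_lt_d2, Real.sqrt_nonneg B]

theorem mul_sq_le_alpha (h : IsOptimalPeeling M L) (l : ℕ) (i : Fin L.length)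
    (hi : i ∈ sizeClass L l) :
    1 / 2048 * (((sizeClass L l).filter (· ≤ i)).card : ℝ) ^ 2 ≤ M.alpha (L.get i) := by
  obtain ⟨θ, hθ, hI⟩ := h.exists_angles
  have hl : (0 : ℝ) < 2 ^ l := by positivity
  have hle := hI (sizeClass L l) (2 ^ (l + 1)) (fun j hj => by
    have := ((Finset.mem_filter.1 hj).2).2
    exact_mod_cast this.trans (Nat.sub_le _ _)) i hi
  have hge : (2 ^ l : ℝ) ≤ (L.get i).card := by
    exact_mod_cast ((Finset.mem_filter.1 hi).2).1
  have hα := (hθ i).sq_mul_card_le (h.not_indep i)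
  set m : ℝ := (((sizeClass L l).filter (· ≤ i)).card : ℝ)
  have hsq := pow_le_pow_left₀ (by positivity) hle 2
  have e : (m * (1 / (8 * √(2 ^ (l + 1))))) ^ 2 = m ^ 2 / (128 * 2 ^ l) := by
    rw [mul_one_div, div_pow, mul_pow, Real.sq_sqrt (by positivity)]
    ring
  rw [e, div_le_iff₀ (by positivity)] at hsq
  have h1 : m ^ 2 ≤ 128 * (θ i ^ 2 * (L.get i).card) := by
    calc m ^ 2 ≤ θ i ^ 2 * (128 * 2 ^ l) := hsq
      _ ≤ θ i ^ 2 * (128 * (L.get i).card) := by gcongr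
      _ = _ := by ring
  -- This yields the constant `2048 = 128 * 16`.
  have hpi : Real.pi ^ 2 ≤ 16 := by nlinarith [Real.pi_pos, Real.pi_lt_four]
  have h2 : Real.pi ^ 2 * M.alpha (L.get i) ≤ 16 * M.alpha (L.get i) := by gcongr
  linarith

theorem card_sizeClass_le (h : IsOptimalPeeling M L) (l : ℕ) :
    ((sizeClass L l).card : ℝ) ≤ 64 * √((2 : ℝ) ^ l) := by
  have hle := h.card_le_of_card_le (sizeClass L l) (2 ^ (l + 1)) (fun j hj => by
    have := ((Finset.mem_filter.1 hj).2).2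
    exact_mod_cast this.trans (Nat.sub_le _ _))
  rw [pow_succ, Real.sqrt_mul (by positivity)] at hle
  have h2 : √(2 : ℝ) ≤ 2 := by
    rw [Real.sqrt_le_left (by norm_num)]; norm_num
  nlinarith [Real.sqrt_nonneg ((2 : ℝ) ^ l)]

theorem sum_card_le (h : IsOptimalPeeling M L) : ∑ i, (L.get i).card ≤ n := by
  rw [← Finset.card_biUnion]
  · exact (Finset.card_le_univ _).trans (Fintype.card_fin n).le
  · intro i _ j _ hij
    rcases lt_or_gt_of_ne hij with hlt | hlt
    · exact h.disjoint hlt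
    · exact (h.disjoint hlt).symm

theorem length_le (h : IsOptimalPeeling M L) : (L.length : ℝ) ≤ 64 * (n : ℝ) ^ (1 / 3 : ℝ) := by
  classical
  rcases Nat.eq_zero_or_pos n with h0 | h0
  · have : L.length = 0 := by
      by_contra hL
      have h1 := card_pos_of_not_indep (h.not_indep ⟨0, Nat.pos_of_ne_zero hL⟩)
      have h2 := Finset.card_le_univ (L.get ⟨0, Nat.pos_of_ne_zero hL⟩)
      rw [Fintype.card_fin] at h2
      omega
    rw [this, Nat.cast_zero]
    positivity
  have hn : (0 : ℝ) < n := by exact_mod_cast h0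
  set r : ℝ := (n : ℝ) ^ (1 / 3 : ℝ) with hr
  have hr0 : 0 < r := by positivity
  have hr3 : r ^ 3 = n := by
    rw [hr, ← Real.rpow_natCast, ← Real.rpow_mul hn.le]; norm_num
  -- The threshold `n ^ (2/3)` balances the two counts: angles control the small sets, disjointness
  -- the large ones.
  let I : Finset (Fin L.length) := Finset.univ.filter fun i => ((L.get i).card : ℝ) ≤ r ^ 2
  let J : Finset (Fin L.length) := Finset.univ.filter fun i => ¬ ((L.get i).card : ℝ) ≤ r ^ 2
  have hI : (I.card : ℝ) ≤ 13 * r := by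
    have := h.card_le_of_card_le I (r ^ 2) fun i hi => (Finset.mem_filter.1 hi).2
    rwa [Real.sqrt_sq hr0.le] at this
  have hJ : (J.card : ℝ) ≤ r := by
    have h1 : (J.card : ℝ) * r ^ 2 ≤ n := by
      calc (J.card : ℝ) * r ^ 2 = ∑ i ∈ J, r ^ 2 := by rw [Finset.sum_const, nsmul_eq_mul]
        _ ≤ ∑ i ∈ J, ((L.get i).card : ℝ) :=
            Finset.sum_le_sum fun i hi => (not_le.1 (Finset.mem_filter.1 hi).2).le
        _ ≤ ∑ i, ((L.get i).card : ℝ) :=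
            Finset.sum_le_sum_of_subset_of_nonneg (Finset.subset_univ _) fun _ _ _ => by positivity
        _ ≤ n := by exact_mod_cast h.sum_card_le
    rw [← hr3, show r ^ 3 = r * r ^ 2 by ring] at h1
    exact le_of_mul_le_mul_right h1 (by positivity)
  have hsum : I.card + J.card = L.length := by
    have := Finset.card_filter_add_card_filter_not (s := (Finset.univ : Finset (Fin L.length)))
      (fun i => ((L.get i).card : ℝ) ≤ r ^ 2)
    rwa [Finset.card_univ, Fintype.card_fin] at this
  rw [← hsum]
  push_cast
  linarith

end IsOptimalPeeling

end Decomposition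

/-! ### The algorithm and its correctness on representative samples. -/

section Algorithm

open Matroid

variable {n N : ℕ}

/-- Judging by the answers `O`, the first circuit among the elements of `R`, added in the order `σ`,
is contained in `S`. -/
def OracleHits (O : Finset (Fin n) → Bool) (R : Finset (Fin n)) (σ : Equiv.Perm (Fin n))
    (S : Finset (Fin n)) : Prop :=
  ∃ k < n, O (R ∩ permPrefix σ k) = true ∧ O (R ∩ permPrefix σ (k + 1)) = false ∧
    ∀ x ∈ R ∩ permPrefix σ (k + 1), O ((R ∩ permPrefix σ (k + 1)).erase x) = true → x ∈ S

/-- The queries by which the first circuits in `R` for the sampled orders are found. -/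
def roundQueries (ω : Fin N → Equiv.Perm (Fin n)) (R : Finset (Fin n)) :
    Finset (Finset (Fin n)) :=
  insert R (Finset.univ.biUnion fun i => (Finset.range (n + 1)).biUnion fun k =>
    insert (R ∩ permPrefix (ω i) k)
      (Finset.univ.image fun x => (R ∩ permPrefix (ω i) k).erase x))

theorem card_roundQueries_le (ω : Fin N → Equiv.Perm (Fin n)) (R : Finset (Fin n)) :
    (roundQueries ω R).card ≤ N * ((n + 1) * (n + 1)) + 1 := by
  refine (Finset.card_insert_le _ _).trans (Nat.succ_le_succ ?_)
  refine (Finset.card_biUnion_le_card_mul _ _ ((n + 1) * (n + 1)) fun i _ => ?_).trans (by simp)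
  refine (Finset.card_biUnion_le_card_mul _ _ (n + 1) fun k _ => ?_).trans (by simp)
  refine (Finset.card_insert_le _ _).trans (Nat.succ_le_succ ?_)
  exact Finset.card_image_le.trans (by simp)

theorem subset_of_mem_roundQueries {ω : Fin N → Equiv.Perm (Fin n)} {R A : Finset (Fin n)}
    (hA : A ∈ roundQueries ω R) : A ⊆ R := by
  simp only [roundQueries, Finset.mem_insert, Finset.mem_biUnion, Finset.mem_image] at hA
  rcases hA with rfl | ⟨i, -, k, -, rfl | ⟨x, -, rfl⟩⟩
  · exact subset_rfl
  · exact Finset.inter_subset_left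
  · exact (Finset.erase_subset _ _).trans Finset.inter_subset_left

theorem inter_permPrefix_mem_roundQueries (ω : Fin N → Equiv.Perm (Fin n)) (R : Finset (Fin n))
    (i : Fin N) {k : ℕ} (hk : k ≤ n) : R ∩ permPrefix (ω i) k ∈ roundQueries ω R := by
  simp only [roundQueries, Finset.mem_insert, Finset.mem_biUnion, Finset.mem_range]
  exact Or.inr ⟨i, Finset.mem_univ _, k, by omega, Or.inl rfl⟩

theorem erase_mem_roundQueries (ω : Fin N → Equiv.Perm (Fin n)) (R : Finset (Fin n))
    (i : Fin N) {k : ℕ} (hk : k ≤ n) (x : Fin n) :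
    (R ∩ permPrefix (ω i) k).erase x ∈ roundQueries ω R := by
  simp only [roundQueries, Finset.mem_insert, Finset.mem_biUnion, Finset.mem_range,
    Finset.mem_image]
  exact Or.inr ⟨i, Finset.mem_univ _, k, by omega, Or.inr ⟨x, Finset.mem_univ _, rfl⟩⟩

/-- In the first dependent prefix, the circuit consists of the elements whose removal restores
independence. So prefixes and their one-element deletions suffice as queries, and they can be asked
non-adaptively. -/
theorem oracleHits_iff {M : Matroid (Fin n)} {R : Finset (Fin n)} (hE : M.E = R)
    {ω : Fin N → Equiv.Perm (Fin n)} {O : Finset (Fin n) → Bool}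
    (hO : ∀ A ∈ roundQueries ω R, O A = true ↔ M.Indep (A : Set (Fin n))) (i : Fin N)
    (S : Finset (Fin n)) :
    OracleHits O R (ω i) S ↔ ∃ C, M.IsFirstCircuitPerm (ω i) C ∧ C ⊆ (S : Set (Fin n)) := by
  have hP : ∀ {k}, k ≤ n → (O (R ∩ permPrefix (ω i) k) = true ↔
      M.Indep (M.E ∩ permPrefix (ω i) k)) := by
    intro k hk
    rw [hO _ (inter_permPrefix_mem_roundQueries ω R i hk), hE, Finset.coe_inter]
  have hX : ∀ {k}, k ≤ n → ∀ x, (O ((R ∩ permPrefix (ω i) k).erase x) = true ↔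
      M.Indep ((M.E ∩ permPrefix (ω i) k) \ {x})) := by
    intro k hk x
    rw [hO _ (erase_mem_roundQueries ω R i hk x), hE, Finset.coe_erase, Finset.coe_inter]
  have hmem : ∀ {k x}, x ∈ R ∩ permPrefix (ω i) k ↔ x ∈ M.E ∩ permPrefix (ω i) k := by
    intro k x
    rw [hE, ← Finset.coe_inter, Finset.mem_coe]
  constructor
  · rintro ⟨k, hk, h1, h2, h3⟩
    rw [hP hk.le] at h1
    rw [← Bool.not_eq_true, hP hk] at h2
    set e := (ω i).symm ⟨k, hk⟩ with he
    have heE : e ∈ M.E := by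
      by_contra hE'
      rw [permPrefix_succ _ hk, Finset.coe_insert, Set.inter_insert_of_notMem hE'] at h2
      exact h2 h1
    have hins : M.E ∩ permPrefix (ω i) (k + 1) = insert e (M.E ∩ permPrefix (ω i) k) := by
      rw [permPrefix_succ _ hk, Finset.coe_insert, Set.inter_insert_of_mem heE]
    have hnot : e ∉ M.E ∩ (permPrefix (ω i) k : Set (Fin n)) := fun h => by
      have := mem_permPrefix.1 (Finset.mem_coe.1 h.2)
      simp [he] at this
    have hcl : e ∈ M.closure (M.E ∩ permPrefix (ω i) k) := by
      by_contra hcl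
      exact h2 (hins ▸ (h1.insert_indep_iff_of_notMem hnot).2 ⟨heE, hcl⟩)
    refine ⟨M.fundCircuit e (M.E ∩ permPrefix (ω i) k),
      ⟨h1.fundCircuit_isCircuit hcl hnot, k, h1, h2, ?_⟩, fun x hx => ?_⟩
    · refine (fundCircuit_subset_insert _ _ _).trans ?_
      rw [← hins]
      exact Set.inter_subset_right
    · refine h3 x (hmem.2 (hins ▸ fundCircuit_subset_insert _ _ _ hx)) ((hX hk x).2 ?_)
      rw [hins]
      exact (h1.mem_fundCircuit_iff hcl hnot).1 hx
  · rintro ⟨C, ⟨hC, k, h1, h2, h3⟩, hCS⟩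
    have hk : k < n := by
      by_contra hk
      rw [permPrefix_of_le _ (by omega)] at h1 h2
      exact h2 h1
    refine ⟨k, hk, (hP hk.le).2 h1, ?_, fun x _ hx => ?_⟩
    · rwa [← Bool.not_eq_true, hP hk]
    · by_contra hxS
      refine hC.not_indep (((hX hk x).1 hx).subset fun y hy => ?_)
      exact ⟨⟨hC.subset_ground hy, h3 hy⟩, fun h => hxS (h ▸ hCS hy)⟩

/-- The fraction of the sampled orders whose first circuit in `R` is contained in `S`. -/
noncomputable def hitFrequency (O : Finset (Fin n) → Bool) (ω : Fin N → Equiv.Perm (Fin n))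
    (R S : Finset (Fin n)) : ℝ :=
  (Nat.card {i // OracleHits O R (ω i) S} : ℝ) / N

/-- The score of a candidate set `S`: large sets pay a logarithmic price. -/
noncomputable def score (O : Finset (Fin n) → Bool) (ω : Fin N → Equiv.Perm (Fin n))
    (R S : Finset (Fin n)) : ℝ :=
  hitFrequency O ω R S - (1 / 2) ^ 20 / Real.logb 2 R.card * Real.log S.card

theorem exists_max_score (O : Finset (Fin n) → Bool) (ω : Fin N → Equiv.Perm (Fin n))
    (R : Finset (Fin n)) : ∃ S ⊆ R, R.Nonempty →
      S.Nonempty ∧ ∀ T ⊆ R, T.Nonempty → score O ω R T ≤ score O ω R S := by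
  classical
  by_cases hR : R.Nonempty
  · obtain ⟨S, hS, hmax⟩ := (R.powerset.filter Finset.Nonempty).exists_max_image (score O ω R)
      ⟨R, by simpa using hR⟩
    simp only [Finset.mem_filter, Finset.mem_powerset] at hS hmax
    exact ⟨S, hS.1, fun _ => ⟨hS.2, fun T hT hT' => hmax T ⟨hT, hT'⟩⟩⟩
  · exact ⟨∅, Finset.empty_subset _, fun h => absurd h hR⟩

/-- A nonempty subset of `R` with the highest score. -/
noncomputable def bestSet (O : Finset (Fin n) → Bool) (ω : Fin N → Equiv.Perm (Fin n))
    (R : Finset (Fin n)) : Finset (Fin n) :=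
  (exists_max_score O ω R).choose

theorem bestSet_subset (O : Finset (Fin n) → Bool) (ω : Fin N → Equiv.Perm (Fin n))
    (R : Finset (Fin n)) : bestSet O ω R ⊆ R :=
  (exists_max_score O ω R).choose_spec.1

theorem bestSet_nonempty (O : Finset (Fin n) → Bool) (ω : Fin N → Equiv.Perm (Fin n))
    {R : Finset (Fin n)} (hR : R.Nonempty) : (bestSet O ω R).Nonempty :=
  ((exists_max_score O ω R).choose_spec.2 hR).1

theorem score_le_score_bestSet (O : Finset (Fin n) → Bool) (ω : Fin N → Equiv.Perm (Fin n))
    {R T : Finset (Fin n)} (hT : T ⊆ R) (hT' : T.Nonempty) :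
    score O ω R T ≤ score O ω R (bestSet O ω R) :=
  ((exists_max_score O ω R).choose_spec.2 (hT'.mono hT)).2 T hT hT'

theorem logb_two_natCast_le (m : ℕ) : Real.logb 2 m ≤ m := by
  rcases Nat.eq_zero_or_pos m with rfl | hm
  · simp
  · rw [Real.logb_le_iff_le_rpow (by norm_num) (by exact_mod_cast hm), Real.rpow_natCast]
    exact_mod_cast Nat.lt_two_pow_self.le

theorem div_logb_mul_log_le (m : ℕ) {a : ℝ} (ha : 0 ≤ a) :
    a / Real.logb 2 m * Real.log m ≤ a * Real.log 2 := by
  by_cases h : Real.log m = 0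
  · rw [h, mul_zero]; positivity
  · rw [Real.logb]; field_simp; rfl

theorem sub_div_le_log_sub_log {s t : ℝ} (ht : 0 < t) (hs : 0 < s) :
    (s - t) / s ≤ Real.log s - Real.log t := by
  have := Real.one_sub_inv_le_log_of_pos (div_pos hs ht)
  rw [Real.log_div hs.ne' ht.ne', inv_div] at this
  rwa [sub_div, div_self hs.ne']

/-- By maximality, deleting `T` from `S` costs frequency at least `2 ^ (-20) / log |R| * ln (|S| /
|S \ T|)`, which is at least twice the required bound. Sampling errors consume at most half of this.
The case `T = S` follows from the circuit mass alone. -/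
theorem globallyOptimal_bestSet {M : Matroid (Fin n)} {R : Finset (Fin n)} (hE : M.E = R)
    (hdep : ¬ M.Indep M.E) {O : Finset (Fin n) → Bool} {ω : Fin N → Equiv.Perm (Fin n)}
    (hfreq : ∀ X, |hitFrequency O ω R X - M.circuitMass X| ≤ (1 / 2) ^ 23 / (n : ℝ) ^ 2) :
    M.GloballyOptimal (bestSet O ω R) := by
  have hR : R.Nonempty := by
    rw [Finset.nonempty_iff_ne_empty]
    rintro rfl
    exact hdep (by rw [hE]; simp)
  set S := bestSet O ω R with hSdef
  have hSR : S ⊆ R := bestSet_subset O ω R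
  have hSE : (S : Set (Fin n)) ⊆ M.E := by rw [hE]; exact_mod_cast hSR
  have hS0 : S.Nonempty := bestSet_nonempty O ω hR
  have hm : 1 ≤ R.card := hR.card_pos
  have hs : 1 ≤ S.card := hS0.card_pos
  have hmn : R.card ≤ n := (Finset.card_le_univ R).trans (Fintype.card_fin n).le
  have hsm : S.card ≤ R.card := Finset.card_le_card hSR
  have hnR : (1 : ℝ) ≤ n := by exact_mod_cast hm.trans hmn
  have hmR : (1 : ℝ) ≤ R.card := by exact_mod_cast hm
  have hsR : (1 : ℝ) ≤ S.card := by exact_mod_cast hs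
  set δ : ℝ := (1 / 2) ^ 23 / (n : ℝ) ^ 2 with hδ
  have hδ1 : δ ≤ (1 / 2) ^ 23 := div_le_self (by positivity) (one_le_pow₀ hnR)
  set l : ℝ := Real.logb 2 R.card with hl
  have hl0 : 0 ≤ l := Real.logb_nonneg (by norm_num) hmR
  have hscore : ∀ T ⊆ R, T.Nonempty →
      hitFrequency O ω R T - (1 / 2) ^ 20 / l * Real.log T.card ≤
        hitFrequency O ω R S - (1 / 2) ^ 20 / l * Real.log S.card :=
    fun T hT hT' => score_le_score_bestSet O ω hT hT'
  have hq : 1 - (1 / 2 : ℝ) ^ 20 ≤ M.circuitMass S := by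
    -- The set `R` has mass `1` and price at most `2 ^ (-20) * ln 2`. Since `ln 2 < 3/4`, the slack
    -- absorbs the two sampling errors of `2 ^ (-23)`.
    have h1 := hscore R subset_rfl hR
    have h2 := div_logb_mul_log_le R.card (a := (1 / 2) ^ 20) (by positivity)
    have h3 : 0 ≤ (1 / 2) ^ 20 / l * Real.log S.card :=
      mul_nonneg (by positivity) (Real.log_nonneg hsR)
    have h4 := (abs_le.1 (hfreq R)).1
    rw [circuitMass_eq_one hdep hE.subset] at h4
    have h5 := (abs_le.1 (hfreq S)).2
    have h6 := Real.log_two_lt_d9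
    norm_num at h1 h2 h3 hδ1 ⊢
    linarith
  refine ⟨hSE, hq, fun T hT => ?_⟩
  have hcard : Nat.card M.E = R.card := by
    rw [hE, Nat.card_eq_fintype_card]; simp
  rw [hcard, ← hl]
  have hp0 : 0 ≤ (M.restrict (S : Set (Fin n))).hittingProb T := unifProb_nonneg _
  -- If `|R| = 1` the logarithm vanishes and the required bound is `0`, by division by zero.
  rcases hl0.eq_or_lt with hl1 | hl1
  · rw [← hl1, mul_zero, div_zero]; exact hp0
  have hl1' : 1 ≤ l := by
    have h2 : 2 ≤ R.card := by
      by_contra h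
      have : R.card = 1 := by omega
      rw [hl, this] at hl1
      simp at hl1
    rw [hl, Real.le_logb_iff_rpow_le (by norm_num) (by linarith), Real.rpow_one]
    exact_mod_cast h2
  rcases T.eq_empty_or_nonempty with rfl | hT0
  · simpa using hp0
  have hTR : (1 : ℝ) ≤ T.card := by exact_mod_cast hT0.card_pos
  have hdel := M.circuitMass_le_add (T := T) hSE
  rcases (S \ T).eq_empty_or_nonempty with hST | hST
  · rw [hST, circuitMass_eq_zero (M := M) (S := ∅) (by simp), zero_add] at hdel
    refine le_trans ?_ (hq.trans hdel)
    have hTS : (T.card : ℝ) ≤ S.card := by exact_mod_cast Finset.card_le_card hT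
    rw [div_le_iff₀ (by positivity)]
    have : (S.card : ℝ) * 1 ≤ S.card * l := by gcongr
    norm_num
    nlinarith
  · have h1 := hscore (S \ T) (Finset.sdiff_subset.trans hSR) hST
    have hST' : (0 : ℝ) < (S \ T).card := by exact_mod_cast hST.card_pos
    have h2 := sub_div_le_log_sub_log hST' (by linarith : (0 : ℝ) < S.card)
    have hsub : (S.card : ℝ) - (S \ T).card = T.card := by
      rw [Finset.card_sdiff_of_subset hT, Nat.cast_sub (Finset.card_le_card hT)]; ring
    rw [hsub] at h2
    have h3 : (1 / 2 : ℝ) ^ 20 / l * (T.card / S.card) ≤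
        (1 / 2) ^ 20 / l * (Real.log S.card - Real.log (S \ T).card) := by gcongr
    have h4 := (abs_le.1 (hfreq S)).2
    have h5 := (abs_le.1 (hfreq (S \ T))).1
    set a : ℝ := T.card / (2 ^ 21 * S.card * l) with ha
    have h6 : (1 / 2 : ℝ) ^ 20 / l * (T.card / S.card) = 2 * a := by
      rw [ha]; field_simp
    -- The accuracy `1 / n ^ 2` is needed here: `|S| * log |R|` can only be bounded by `n ^ 2`.
    have h7 : 2 * δ ≤ a := by
      have hln : (S.card : ℝ) * l ≤ n ^ 2 := by
        have e1 : (S.card : ℝ) ≤ n := by exact_mod_cast hsm.trans hmn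
        have e2 : l ≤ n := (logb_two_natCast_le _).trans (by exact_mod_cast hmn)
        rw [sq]; gcongr
      rw [ha, hδ, mul_div_assoc', div_le_div_iff₀ (by positivity) (by positivity)]
      have : (n : ℝ) ^ 2 ≤ T.card * n ^ 2 := le_mul_of_one_le_left (by positivity) hTR
      have : 0 ≤ (S.card : ℝ) * l := by positivity
      norm_num
      linarith
    rw [mul_sub] at h3
    linarith

/-- The answers to the queries in `Q`, continued by `false` to all sets. -/
noncomputable def extendAnswers (Q : Finset (Finset (Fin n))) (ans : {A // A ∈ Q} → Bool) :
    Finset (Fin n) → Bool :=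
  open Classical in fun A => if h : A ∈ Q then ans ⟨A, h⟩ else false

theorem extendAnswers_apply (Q : Finset (Finset (Fin n))) (O : Finset (Fin n) → Bool)
    {A : Finset (Fin n)} (hA : A ∈ Q) : extendAnswers Q (fun A => O A.1) A = O A := by
  simp [extendAnswers, hA]

/-- The peeling algorithm on the remaining elements `R`, for at most `f` rounds: it stops when `R` is
independent, and otherwise peels off a set of highest score. -/
noncomputable def peelingAlgorithm (ω : Fin N → Equiv.Perm (Fin n)) :
    ℕ → Finset (Fin n) → PeelingAlgorithm (Fin n)
  | 0, _ => .halt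
  | f + 1, R => .round (roundQueries ω R)
      (fun ans => if extendAnswers _ ans R = true then .done
        else .peel (bestSet (extendAnswers _ ans) ω R))
      (fun ans => peelingAlgorithm ω f (R \ bestSet (extendAnswers _ ans) ω R))

theorem queryCount_peelingAlgorithm_le (ω : Fin N → Equiv.Perm (Fin n))
    (O : Finset (Fin n) → Bool) (f : ℕ) (R : Finset (Fin n)) :
    (peelingAlgorithm ω f R).queryCount O ≤ f * (N * ((n + 1) * (n + 1)) + 1) := by
  induction f generalizing R with
  | zero => simp [peelingAlgorithm, PeelingAlgorithm.queryCount]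
  | succ f ih =>
    rw [peelingAlgorithm, PeelingAlgorithm.queryCount, add_mul, one_mul, add_comm]
    refine add_le_add ?_ (card_roundQueries_le ω R)
    split_ifs with h
    · exact Nat.zero_le _
    · exact ih _

/-- Induction on the allowed number of rounds, with `L₀` the sets already peeled. Each best set is
nonempty, so `f ≥ |R|` is preserved and running out of rounds means that `R` is empty. Since `hω`
covers every `R`, the samples remain usable although `R` depends on them. -/
theorem run_peelingAlgorithm {M : Matroid (Fin n)} {ω : Fin N → Equiv.Perm (Fin n)}
    (hω : ∀ R X : Finset (Fin n), |(Nat.card {i // ∃ C,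
      (M.restrict (R : Set (Fin n))).IsFirstCircuitPerm (ω i) C ∧ C ⊆ (X : Set (Fin n))} : ℝ) / N -
        (M.restrict (R : Set (Fin n))).circuitMass X| ≤ (1 / 2) ^ 23 / (n : ℝ) ^ 2)
    (f : ℕ) (R : Finset (Fin n)) (hf : R.card ≤ f) (L₀ : List (Finset (Fin n)))
    (hR : (M.peelOff L₀).E = R) {L : List (Finset (Fin n))} {r : Option (Finset (Fin n))}
    (hrun : (peelingAlgorithm ω f R).run M.indepOracle = (L, r)) :
    (∀ (i : ℕ) (hi : i < L.length), (M.peelOff (L₀ ++ L.take i)).GloballyOptimal L[i]) ∧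
      r = none ∧ ∀ C, ¬ (M.peelOff (L₀ ++ L)).IsCircuit C := by
  induction f generalizing R L₀ L r with
  | zero =>
    simp only [peelingAlgorithm, PeelingAlgorithm.run, Prod.mk.injEq] at hrun
    obtain ⟨rfl, rfl⟩ := hrun
    refine ⟨fun i hi => absurd hi (by simp), rfl, fun C hC => ?_⟩
    rw [List.append_nil] at hC
    obtain ⟨x, hx⟩ := hC.nonempty
    have := hR.subset (hC.subset_ground hx)
    rw [Finset.card_eq_zero.1 (Nat.le_zero.1 hf)] at this
    simp at this
  | succ f ih =>
    set O := extendAnswers (roundQueries ω R) (fun A => M.indepOracle A.1) with hOdef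
    have hO : ∀ A ∈ roundQueries ω R, O A = true ↔
        (M.peelOff L₀).Indep (A : Set (Fin n)) := by
      intro A hA
      rw [hOdef, extendAnswers_apply _ _ hA, M.peelOff_indep_iff]
      · simp [indepOracle]
      · rw [hR]; exact_mod_cast subset_of_mem_roundQueries hA
    have hOR := hO R (Finset.mem_insert_self _ _)
    rw [peelingAlgorithm, PeelingAlgorithm.run] at hrun
    by_cases hRi : O R = true
    · simp only [← hOdef, hRi, if_true, Prod.mk.injEq] at hrun
      obtain ⟨rfl, rfl⟩ := hrun
      refine ⟨fun i hi => absurd hi (by simp), rfl, fun C hC => ?_⟩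
      rw [List.append_nil] at hC
      exact hC.not_indep ((hOR.1 hRi).subset (hR ▸ hC.subset_ground))
    · simp only [← hOdef, if_neg hRi, Prod.mk.injEq] at hrun
      set S := bestSet O ω R with hS
      have hdep : ¬ (M.peelOff L₀).Indep (M.peelOff L₀).E := by rwa [hR, ← hOR]
      have hRne : R.Nonempty := by
        rw [Finset.nonempty_iff_ne_empty]
        intro h
        exact hdep (by rw [hR, h]; simp)
      have hopt : (M.peelOff L₀).GloballyOptimal S := by
        refine globallyOptimal_bestSet hR hdep fun X => ?_
        have hMR : M.peelOff L₀ = M.restrict (R : Set (Fin n)) := by rw [← hR]; rfl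
        have := hω R X
        rw [← hMR] at this
        simpa only [hitFrequency, oracleHits_iff hR hO] using this
      obtain ⟨hL, hr⟩ := hrun
      have hSR : S ⊆ R := bestSet_subset O ω R
      have hcard : (R \ S).card ≤ f := by
        have h1 : 0 < S.card := (bestSet_nonempty O ω hRne).card_pos
        have h3 := Finset.card_le_card hSR
        have h2 := Finset.card_sdiff_of_subset hSR
        omega
      have hR' : (M.peelOff (L₀ ++ [S])).E = (R \ S : Finset (Fin n)) := by
        ext x
        have := Set.ext_iff.1 hR x
        rw [mem_peelOff_ground, Finset.mem_coe] at this
        rw [mem_peelOff_ground, Finset.mem_coe, Finset.mem_sdiff, ← this]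
        simp only [List.mem_append, List.mem_singleton, or_imp, forall_and, forall_eq]
        tauto
      obtain ⟨h1, h2, h3⟩ := ih (R \ S) hcard (L₀ ++ [S]) hR' rfl
      subst hL
      refine ⟨fun i hi => ?_, hr ▸ h2, ?_⟩
      · cases i with
        | zero => simpa using hopt
        | succ i => simpa using h1 i (by simpa using hi)
      · simpa using h3

end Algorithm

/-! ### Sample size and conclusion. -/

section Main

/-- The samples represent the circuit masses in all restrictions of `M`, with high probability. -/
theorem unifProb_samples_good {n N : ℕ} (hn : 0 < n) (hN : N = 2 ^ 50 * n ^ 5)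
    (M : Matroid (Fin n)) :
    1 - (2 : ℝ) ^ (-(n : ℝ)) ≤
      unifProb fun ω : Fin N → Equiv.Perm (Fin n) => ∀ R X : Finset (Fin n),
        |(Nat.card {i // ∃ C, (M.restrict (R : Set (Fin n))).IsFirstCircuitPerm (ω i) C ∧
          C ⊆ (X : Set (Fin n))} : ℝ) / N -
            (M.restrict (R : Set (Fin n))).circuitMass X| ≤ (1 / 2) ^ 23 / (n : ℝ) ^ 2 := by
  classical
  set δ : ℝ := (1 / 2) ^ 23 / (n : ℝ) ^ 2 with hδ
  have hn1 : (1 : ℝ) ≤ n := by exact_mod_cast hn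
  have hδ0 : 0 ≤ δ := by positivity
  have hN0 : 0 < N := by rw [hN]; positivity
  have hδ1 : δ ≤ 1 := by
    rw [hδ]
    exact (div_le_self (by positivity) (one_le_pow₀ hn1)).trans (by norm_num)
  -- The sample size is chosen for this exponent: the union bound is then `4 ^ n * 2 * exp (-4 *
  -- n)`, and `exp (-4 * n) ≤ 16 ^ (-n)`.
  have hexp : (N : ℝ) * δ ^ 2 / 4 = 4 * n := by
    rw [hN, hδ]; push_cast; field_simp; norm_num
  let P : Finset (Fin n) × Finset (Fin n) → (Fin N → Equiv.Perm (Fin n)) → Prop := fun p ω =>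
    δ < |(Nat.card {i // ∃ C, (M.restrict (p.1 : Set (Fin n))).IsFirstCircuitPerm (ω i) C ∧
      C ⊆ (p.2 : Set (Fin n))} : ℝ) / N - (M.restrict (p.1 : Set (Fin n))).circuitMass p.2|
  have hP : ∀ p, unifProb (P p) ≤ 2 * Real.exp (-(4 * n)) := by
    intro p
    have h := unifProb_abs_freq_sub_le (A := Equiv.Perm (Fin n)) (fun σ => ∃ C,
      (M.restrict (p.1 : Set (Fin n))).IsFirstCircuitPerm σ C ∧ C ⊆ (p.2 : Set (Fin n)))
      hN0 hδ0 hδ1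
    rw [← Matroid.circuitMass_eq, hexp] at h
    exact h
  have hbad : unifProb (fun ω => ∃ p, P p ω) ≤ (2 : ℝ) ^ (-(n : ℝ)) := by
    refine (unifProb_exists_le P).trans ((Finset.sum_le_sum fun p _ => hP p).trans ?_)
    rw [Finset.sum_const, Finset.card_univ, Fintype.card_prod, Fintype.card_finset,
      Fintype.card_fin, nsmul_eq_mul, Real.rpow_neg (by norm_num), Real.rpow_natCast, Real.exp_neg,
      ← div_eq_mul_inv, ← mul_div_assoc, div_le_iff₀ (Real.exp_pos _), inv_mul_eq_div,
      le_div_iff₀ (by positivity)]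
    have he : (16 : ℝ) ^ n ≤ Real.exp (4 * n) := by
      rw [mul_comm, Real.exp_nat_mul]
      gcongr
      have : Real.exp 4 = Real.exp 1 ^ 4 := by rw [← Real.exp_nat_mul]; norm_num
      rw [this]
      have h2 : (2 : ℝ) ≤ Real.exp 1 := by linarith [Real.add_one_le_exp (1 : ℝ)]
      calc (16 : ℝ) = 2 ^ 4 := by norm_num
        _ ≤ _ := by gcongr
    refine le_trans ?_ he
    have h2 : (2 : ℝ) ≤ 2 ^ n := by
      calc (2 : ℝ) = 2 ^ 1 := by norm_num
        _ ≤ 2 ^ n := by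
          gcongr
          · norm_num
          · exact hn
    have h16 : (16 : ℝ) ^ n = 2 ^ n * 2 ^ n * 2 ^ n * 2 ^ n := by
      rw [← mul_pow, ← mul_pow, ← mul_pow]; norm_num
    rw [h16]
    push_cast
    have h8 : (0 : ℝ) ≤ 2 ^ n * 2 ^ n * 2 ^ n := by positivity
    calc (2 : ℝ) ^ n * 2 ^ n * 2 * 2 ^ n = 2 ^ n * 2 ^ n * 2 ^ n * 2 := by ring
      _ ≤ _ := by gcongr
  have hnot := unifProb_not fun ω => ∃ p, P p ω
  refine le_trans (by linarith) (hnot.symm.le.trans (unifProb_mono ?_))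
  intro ω hω R X
  by_contra h
  exact hω ⟨(R, X), not_le.1 h⟩

theorem rounds_mul_queries_le {n N : ℕ} (hN : N = 2 ^ 50 * n ^ 5) :
    n * (N * ((n + 1) * (n + 1)) + 1) ≤ 2 ^ 53 * n ^ 8 := by
  subst hN
  rcases Nat.eq_zero_or_pos n with rfl | hn
  · simp
  have h1 : (n + 1) * (n + 1) ≤ (2 * n) * (2 * n) := by gcongr <;> omega
  have h2 : 1 ≤ 2 ^ 52 * n ^ 7 := Nat.one_le_iff_ne_zero.2 (by positivity)
  calc n * (2 ^ 50 * n ^ 5 * ((n + 1) * (n + 1)) + 1)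
      ≤ n * (2 ^ 50 * n ^ 5 * ((2 * n) * (2 * n)) + 2 ^ 52 * n ^ 7) := by gcongr
    _ = 2 ^ 53 * n ^ 8 := by ring

end Main

theorem lemma3 :
    ∃ (c C : ℝ) (K d : ℕ), 0 < c ∧ 0 < C ∧
      ∀ n : ℕ, ∃ (Ω : Type) (_ : Fintype Ω) (_ : Nonempty Ω) (A : Ω → PeelingAlgorithm (Fin n)),
        ∀ M : Matroid (Fin n), M.E = Set.univ →
          (∀ ω, (A ω).queryCount M.indepOracle ≤ K * n ^ d) ∧
          1 - (2 : ℝ) ^ (-(c * (n : ℝ))) ≤ unifProb fun ω : Ω =>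
            ∀ (L : List (Finset (Fin n))) (r : Option (Finset (Fin n))),
              (A ω).run M.indepOracle = (L, r) →
                (∀ i : Fin L.length, (M.peelOff (L.take i)).GloballyOptimal (L.get i)) ∧
                StoppingRule M L r ∧
                (∀ l : ℕ,
                  (∀ i ∈ sizeClass L l,
                    c * (((sizeClass L l).filter (· ≤ i)).card : ℝ) ^ 2 ≤
                      (M.alpha (L.get i) : ℝ)) ∧
                  ((sizeClass L l).card : ℝ) ≤ C * √((2 : ℝ) ^ l)) ∧
                (L.length : ℝ) ≤ C * (n : ℝ) ^ (1 / 3 : ℝ) ∧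
                (∀ i j : Fin L.length, i < j →
                  c * ((M.alpha (L.get i) : ℝ) / ((L.get i).card : ℝ)) ≤
                    (M.alpha (L.get j) : ℝ) / ((L.get j).card : ℝ)) := by
  refine ⟨1 / 2048, 64, 2 ^ 53, 8, by norm_num, by norm_num, fun n => ?_⟩
  obtain ⟨N, hN⟩ : ∃ N, N = 2 ^ 50 * n ^ 5 := ⟨_, rfl⟩
  refine ⟨Fin N → Equiv.Perm (Fin n), inferInstance, inferInstance,
    fun ω => peelingAlgorithm ω n Finset.univ, fun M hM => ⟨fun ω => ?_, ?_⟩⟩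
  · exact (queryCount_peelingAlgorithm_le ω _ n _).trans (rounds_mul_queries_le hN)
  · rcases Nat.eq_zero_or_pos n with rfl | hn
    -- For `n = 0` the required probability is `1 - 2 ^ 0 = 0`.
    · simpa using unifProb_nonneg _
    · have hle : (2 : ℝ) ^ (-(n : ℝ)) ≤ (2 : ℝ) ^ (-(1 / 2048 * (n : ℝ))) := by
        have : (0 : ℝ) ≤ n := Nat.cast_nonneg n
        gcongr
        · norm_num
        · linarith
      refine le_trans (by linarith) ((unifProb_samples_good hn hN M).trans (unifProb_mono ?_))
      intro ω hω L r hrun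
      -- No run ends with a rejection, so the stopping rule holds through its alternative that no
      -- circuit is left.
      obtain ⟨h1, rfl, h3⟩ := run_peelingAlgorithm hω n Finset.univ (by simp) []
        (by simp [Matroid.peelOff, hM]) hrun
      have hopt : IsOptimalPeeling M L := fun i => h1 i i.2
      refine ⟨hopt, h3, fun l => ⟨hopt.mul_sq_le_alpha l, hopt.card_sizeClass_le l⟩,
        hopt.length_le, fun i j hij => le_trans ?_ (hopt.ratio_le hij)⟩
      gcongr
      norm_num
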